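/- **Theorem 3.1.** Let $K$ be a field, let $0<a<b<c$ be integers with $\gcd(a,b,c)=1$ and $a+b>c$, and let $I=(u_1,u_2,u_3,u_4)=(x^c,\,x^by^a,\,x^ay^b,\,y^c)\subset K[x,y]$. Let $F(I)=\bigoplus_{j\ge 0}I^j/\mathfrak m I^j$, with $\mathfrak m=(x,y)$, be the fiber cone of $I$ (its depth is taken with respect to its graded maximal ideal), and let $J$ be the kernel of the $K$-algebra homomorphism $K[z_1,z_2,z_3,z_4]\to F(I)$, $z_i\mapsto u_i+\mathfrak m I$. Put $\ell=\frac{b-a}{\gcd(c,b-a)}$ and $m=\frac{c}{\gcd(c,b-a)}$. (a) The ideal $J$ is minimally generated by one of the following four sets, for some integer $r$ in (i), (ii), (iv) and some non-empty finite set $A$ of pairs of positive integers in (ii), (iv): (i) $z_2z_3,\ z_2^r,\ z_3^r$; (ii) $z_2z_3,\ z_2^r,\ z_3^r$, together with the monomials $z_1^iz_3^j$ and $z_2^jz_4^i$ for $(i,j)\in A$; (iii) $z_2z_3,\ z_2^{m+1},\ z_3^{m+1},\ z_1^\ell z_3^m-z_2^mz_4^\ell$; (iv) $z_2z_3,\ z_2^r,\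 z_3^r,\ z_1^\ell z_3^m-z_2^mz_4^\ell$, together with the monomials $z_1^iz_3^j$ and $z_2^jz_4^i$ for $(i,j)\in A$. Over every field $K$, each of the four cases occurs for some such $a,b,c$. (b) $F(I)$ is Cohen–Macaulay if and only if $J$ is minimally generated as in case (i). Otherwise, $\operatorname{depth}F(I)=1$. -/

import Mathlib

/-- The fiber cone `F(I) = R(I) / 𝔪 R(I) = ⨁ⱼ Iʲ / 𝔪 Iʲ` of the ideal `I` with respect to the
ideal `𝔪`, where `R(I) = ⨁ⱼ Iʲ tʲ` is the Rees algebra of `I`. -/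
abbrev FiberCone {S : Type*} [CommRing S] (𝔪 I : Ideal S) : Type _ :=
  reesAlgebra I ⧸ 𝔪.map (algebraMap S (reesAlgebra I))

/-- The ideal `F(I)₊ = ⨁_{j > 0} Iʲ / 𝔪 Iʲ` of `F(I)`: the image of the ideal of all elements of
the Rees algebra whose degree-zero component vanishes. If `S / 𝔪` is a field, then this is the
graded maximal ideal of `F(I)`. -/
noncomputable def fiberConeIrrelevant {S : Type*} [CommRing S] (𝔪 I : Ideal S) :
    Ideal (FiberCone 𝔪 I) :=
  (RingHom.ker ((Polynomial.constantCoeff (R := S)).comp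
    (reesAlgebra I).val.toRingHom)).map
      (Ideal.Quotient.mk (𝔪.map (algebraMap S (reesAlgebra I))))

/-- The element of degree one of the fiber cone which is given by an element `u` of `I`,
i.e. the class `u + 𝔪 I`. -/
noncomputable def fiberConeOf {S : Type*} [CommRing S] (𝔪 I : Ideal S) (u : S) (hu : u ∈ I) :
    FiberCone 𝔪 I :=
  Ideal.Quotient.mk (𝔪.map (algebraMap S (reesAlgebra I)))
    ⟨Polynomial.monomial 1 u, reesAlgebra.monomial_mem.mpr (by simpa using hu)⟩

/-- The supremum of the lengths of the `R`-regular sequences all of whose members lie in the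
ideal `𝔫`. For a standard graded `K`-algebra `R` with graded maximal ideal `𝔫` this is
`depth R`. -/
noncomputable def depthAlong {R : Type*} [CommRing R] (𝔫 : Ideal R) : ℕ∞ :=
  ⨆ (rs : List R) (_ : (∀ r ∈ rs, r ∈ 𝔫) ∧ RingTheory.Sequence.IsRegular R rs),
    (rs.length : ℕ∞)

/-- `G` is a minimal (i.e. irredundant) set of generators of the ideal `J`. -/
def IsMinimalGeneratingSet {R : Type*} [CommRing R] (G : Set R) (J : Ideal R) : Prop :=
  Ideal.span G = J ∧ ∀ g ∈ G, g ∉ Ideal.span (G \ {g})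

section SymmetricIdeal

/-- The monomials `u₁ = x ^ c`, `u₂ = x ^ b * y ^ a`, `u₃ = x ^ a * y ^ b`, `u₄ = y ^ c` in
`K[x, y]`, where `x = X 0` and `y = X 1`; here `uₖ` has the index `k - 1`. -/
noncomputable def symGen (K : Type*) [Field K] (a b c : ℕ) : Fin 4 → MvPolynomial (Fin 2) K :=
  ![MvPolynomial.X 0 ^ c, MvPolynomial.X 0 ^ b * MvPolynomial.X 1 ^ a,
    MvPolynomial.X 0 ^ a * MvPolynomial.X 1 ^ b, MvPolynomial.X 1 ^ c]

/-- The symmetric ideal `I = (x ^ c, x ^ b * y ^ a, x ^ a * y ^ b, y ^ c)`. -/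
noncomputable def symIdeal (K : Type*) [Field K] (a b c : ℕ) : Ideal (MvPolynomial (Fin 2) K) :=
  Ideal.span (Set.range (symGen K a b c))

/-- The graded maximal ideal `𝔪 = (x, y)` of `K[x, y]`. -/
noncomputable def maxIdealXY (K : Type*) [Field K] : Ideal (MvPolynomial (Fin 2) K) :=
  Ideal.span {MvPolynomial.X 0, MvPolynomial.X 1}

/-- The fiber cone `F(I)` of the symmetric ideal `I`. -/
abbrev SymFiberCone (K : Type*) [Field K] (a b c : ℕ) : Type _ :=
  FiberCone (maxIdealXY K) (symIdeal K a b c)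

/-- The canonical homomorphism of `K`-algebras `K[z₁, …, z₄] → F(I)`, `zᵢ ↦ uᵢ + 𝔪 I`. -/
noncomputable def symFiberMap (K : Type*) [Field K] (a b c : ℕ) :
    MvPolynomial (Fin 4) K →ₐ[K] SymFiberCone K a b c :=
  MvPolynomial.aeval fun i =>
    fiberConeOf (maxIdealXY K) (symIdeal K a b c) (symGen K a b c i)
      (Ideal.subset_span (Set.mem_range_self i))

/-- The defining ideal `J` of `F(I)`. -/
noncomputable def symDefIdeal (K : Type*) [Field K] (a b c : ℕ) :
    Ideal (MvPolynomial (Fin 4) K) :=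
  RingHom.ker (symFiberMap K a b c)

/-- `depth F(I)`. -/
noncomputable def symDepth (K : Type*) [Field K] (a b c : ℕ) : ℕ∞ :=
  depthAlong (R := SymFiberCone K a b c) (fiberConeIrrelevant (maxIdealXY K) (symIdeal K a b c))

/-- The standard graded `K`-algebra `F(I)` is Cohen–Macaulay: its depth equals its Krull
dimension. -/
def SymFiberConeIsCM (K : Type*) [Field K] (a b c : ℕ) : Prop :=
  (symDepth K a b c : WithBot ℕ∞) = ringKrullDim (SymFiberCone K a b c)

/-- `ℓ = (b - a) / gcd(c, b - a)`, used for `a < b` only; the division is exact. -/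
def symL (a b c : ℕ) : ℕ := (b - a) / Nat.gcd c (b - a)

/-- `m = c / gcd(c, b - a)`, used for `a < b` only; the division is exact. -/
def symM (a b c : ℕ) : ℕ := c / Nat.gcd c (b - a)

/-- The monomials `z₂ * z₃`, `z₂ ^ r`, `z₃ ^ r`. Here and below `zₖ` is `X (k - 1)`. -/
def baseMonomials (K : Type*) [Field K] (r : ℕ) : Set (MvPolynomial (Fin 4) K) :=
  {MvPolynomial.X 1 * MvPolynomial.X 2, MvPolynomial.X 1 ^ r, MvPolynomial.X 2 ^ r}

/-- The monomials `z₁ ^ i * z₃ ^ j` and `z₂ ^ j * z₄ ^ i` with `(i, j) ∈ A`. -/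
def mixedMonomials (K : Type*) [Field K] (A : Finset (ℕ × ℕ)) :
    Set (MvPolynomial (Fin 4) K) :=
  {p | ∃ q ∈ A, p = MvPolynomial.X 0 ^ q.1 * MvPolynomial.X 2 ^ q.2 ∨
    p = MvPolynomial.X 1 ^ q.2 * MvPolynomial.X 3 ^ q.1}

/-- The binomial `z₁ ^ ℓ * z₃ ^ m - z₂ ^ m * z₄ ^ ℓ`. -/
noncomputable def symBinomial (K : Type*) [Field K] (a b c : ℕ) : MvPolynomial (Fin 4) K :=
  MvPolynomial.X 0 ^ symL a b c * MvPolynomial.X 2 ^ symM a b c -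
    MvPolynomial.X 1 ^ symM a b c * MvPolynomial.X 3 ^ symL a b c

/-- Case (i): `J` is minimally generated by `z₂z₃, z₂ʳ, z₃ʳ`. -/
def CaseI (K : Type*) [Field K] (a b c : ℕ) : Prop :=
  ∃ r : ℕ, IsMinimalGeneratingSet (baseMonomials K r) (symDefIdeal K a b c)

/-- Case (ii): `J` is minimally generated by `z₂z₃, z₂ʳ, z₃ʳ` and a non-empty collection of pairs
of monomials `z₁ⁱz₃ʲ`, `z₂ʲz₄ⁱ` with `i, j > 0`. -/
def CaseII (K : Type*) [Field K] (a b c : ℕ) : Prop :=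
  ∃ (r : ℕ) (A : Finset (ℕ × ℕ)), A.Nonempty ∧ (∀ q ∈ A, 0 < q.1 ∧ 0 < q.2) ∧
    IsMinimalGeneratingSet (baseMonomials K r ∪ mixedMonomials K A) (symDefIdeal K a b c)

/-- Case (iii): `J` is minimally generated by `z₂z₃`, `z₂ ^ (m + 1)`, `z₃ ^ (m + 1)` and the
binomial. -/
def CaseIII (K : Type*) [Field K] (a b c : ℕ) : Prop :=
  IsMinimalGeneratingSet (baseMonomials K (symM a b c + 1) ∪ {symBinomial K a b c})
    (symDefIdeal K a b c)

/-- Case (iv): `J` is minimally generated by `z₂z₃, z₂ʳ, z₃ʳ`, the binomial and a non-empty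
collection of pairs of monomials `z₁ⁱz₃ʲ`, `z₂ʲz₄ⁱ` with `i, j > 0`. -/
def CaseIV (K : Type*) [Field K] (a b c : ℕ) : Prop :=
  ∃ (r : ℕ) (A : Finset (ℕ × ℕ)), A.Nonempty ∧ (∀ q ∈ A, 0 < q.1 ∧ 0 < q.2) ∧
    IsMinimalGeneratingSet
      (baseMonomials K r ∪ {symBinomial K a b c} ∪ mixedMonomials K A) (symDefIdeal K a b c)

/-- The standing assumptions `0 < a < b < c`, `gcd(a, b, c) = 1` together with `a + b > c`. -/
def IsUpTriple (a b c : ℕ) : Prop :=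
  0 < a ∧ a < b ∧ b < c ∧ Nat.gcd a (Nat.gcd b c) = 1 ∧ c < a + b

end SymmetricIdeal

/-! A product of `n` of the monomials `uᵢ` has total degree `c n + (a + b - c) e`, where `e` counts
the factors `u₂` and `u₃`. As `a + b > c`, among products of the same length proper divisibility is
divisibility with a smaller `e` (this is `IsZeroExp`), and equal products have equal `e`. The
classes of the minimal monomials of `Iⁿ` form a basis of `Iⁿ / 𝔪 Iⁿ`, so a polynomial lies in `J`
exactly when, over each class of equal nonvanishing products, its coefficients sum to zero
(`mem_symDefIdeal_iff`).

The product `z₂z₃` vanishes, because `u₁u₄` properly divides `u₂u₃`. Hence a coincidence between two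
different surviving monomials trades a power of `z₂` for a power of `z₃`; coprimality of `ℓ` and `m`
makes it a multiple of the binomial applied `s` times, and `s ≥ 2` produces `z₂z₃`
(`SameExp.eq_or_binomial`). So `J` is generated by vanishing monomials and the one binomial. Next to
`z₂` a factor `z₁` can be cancelled without affecting vanishing, and symmetrically for `z₃`, `z₄`
(`IsZeroExp.cancel`), which leaves only the listed shapes of minimal monomials (`minZeroSet_cases`).
The four cases answer two questions: are there mixed monomials (`NoMixed`), and does `z₁^ℓ z₃^m`
vanish?

For the depth, `J : z₂` and `J + (z₂)` are monomial ideals, and `z₁ + z₄` is a nonzerodivisor modulo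
both, hence modulo `J`; so the depth is at least one. The dimension is two, since `J` has radical
`(z₂, z₃)`. In case (i) the generators involve neither `z₁` nor `z₄`, and these form a regular
sequence. Otherwise a fraction `v / z` with `v ∉ (z)` is moved into the ring by powers of all
generators, which excludes a regular sequence of length two (`depthAlong_le_one_of_radical`): the
fraction is `z₂ᵏ / z₁` when there are mixed monomials, and `z₃^m / z₄^ℓ` when only the binomial is
extra. -/

/-- The exponent vector `(i, j, k, l)` of a monomial `z₁ⁱz₂ʲz₃ᵏz₄ˡ` such that the monomial
`u₁ⁱu₂ʲu₃ᵏu₄ˡ` is properly divisible by a monomial in the `uₖ` of the same degree. -/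
def IsZeroExp (a b c i j k l : ℕ) : Prop :=
  ∃ p q s t, p + q + s + t = i + j + k + l ∧ q + s < j + k ∧
    c * p + b * q + a * s ≤ c * i + b * j + a * k ∧ a * q + b * s + c * t ≤ a * j + b * k + c * l

/-- Two monomials of the same degree in `z₁, …, z₄` have the same image in `K[x, y]`. -/
def SameExp (a b c i j k l i' j' k' l' : ℕ) : Prop :=
  i + j + k + l = i' + j' + k' + l' ∧ c * i + b * j + a * k = c * i' + b * j' + a * k' ∧
    a * j + b * k + c * l = a * j' + b * k' + c * l'

theorem IsZeroExp.symm {a b c i j k l : ℕ} (h : IsZeroExp a b c i j k l) :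
    IsZeroExp a b c l k j i := by
  obtain ⟨p, q, s, t, h1, h2, h3, h4⟩ := h
  exact ⟨t, s, q, p, by omega, by omega, by omega, by omega⟩

theorem SameExp.symm {a b c i j k l i' j' k' l' : ℕ} (h : SameExp a b c i j k l i' j' k' l') :
    SameExp a b c i' j' k' l' i j k l := ⟨h.1.symm, h.2.1.symm, h.2.2.symm⟩

theorem SameExp.swap {a b c i j k l i' j' k' l' : ℕ} (h : SameExp a b c i j k l i' j' k' l') :
    SameExp a b c l k j i l' k' j' i' := by
  obtain ⟨h1, h2, h3⟩ := h
  exact ⟨by omega, by omega, by omega⟩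

theorem IsZeroExp.mono {a b c i j k l i' j' k' l' : ℕ} (h : IsZeroExp a b c i j k l)
    (hi : i ≤ i') (hj : j ≤ j') (hk : k ≤ k') (hl : l ≤ l') : IsZeroExp a b c i' j' k' l' := by
  obtain ⟨p, q, s, t, h1, h2, h3, h4⟩ := h
  obtain ⟨i', rfl⟩ := Nat.exists_eq_add_of_le hi
  obtain ⟨j', rfl⟩ := Nat.exists_eq_add_of_le hj
  obtain ⟨k', rfl⟩ := Nat.exists_eq_add_of_le hk
  obtain ⟨l', rfl⟩ := Nat.exists_eq_add_of_le hl
  exact ⟨p + i', q + j', s + k', t + l', by omega, by omega, by linarith, by linarith⟩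

theorem not_isZeroExp_pure {a b c i l : ℕ} : ¬ IsZeroExp a b c i 0 0 l := by
  rintro ⟨p, q, s, t, h1, h2, h3, h4⟩
  omega

/-! ### Arithmetic of exponents: vanishing, cancellation and coincidences. -/

section UpTriple

variable {a b c : ℕ}

/-- Adding the two coordinates gives the total degree, in which `j + k` has the nonzero coefficient
`a + b - c`. -/
theorem SameExp.add_eq (h : IsUpTriple a b c) {i j k l i' j' k' l' : ℕ}
    (hs : SameExp a b c i j k l i' j' k' l') : j + k = j' + k' := by
  obtain ⟨ha, hab, hbc, -, hc⟩ := h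
  obtain ⟨h1, h2, h3⟩ := hs
  zify at *
  have : ((a : ℤ) + b - c) * (j + k - (j' + k')) = 0 := by linear_combination h2 + h3 - c * h1
  rcases mul_eq_zero.mp this with h | h <;> linarith

theorem IsZeroExp.congr (h : IsUpTriple a b c) {i j k l i' j' k' l' : ℕ}
    (hz : IsZeroExp a b c i j k l) (hs : SameExp a b c i j k l i' j' k' l') :
    IsZeroExp a b c i' j' k' l' := by
  obtain ⟨p, q, s, t, h1, h2, h3, h4⟩ := hz
  have := hs.add_eq h
  obtain ⟨h5, h6, h7⟩ := hs
  exact ⟨p, q, s, t, by omega, by omega, by omega, by omega⟩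

theorem isZeroExp_of_pos (h : IsUpTriple a b c) {i j k l : ℕ} (hj : 0 < j) (hk : 0 < k) :
    IsZeroExp a b c i j k l := by
  obtain ⟨ha, hab, hbc, -, hc⟩ := h
  have : IsZeroExp a b c 0 1 1 0 := ⟨1, 0, 0, 1, by omega, by omega, by omega, by omega⟩
  exact this.mono (by omega) (by omega) (by omega) (by omega)

/-- A smaller product could only use `u₁` and `u₄`, but a single `u₂` supplies less than a full `c`
in either variable. -/
theorem not_isZeroExp_one (h : IsUpTriple a b c) {i l : ℕ} : ¬ IsZeroExp a b c i 1 0 l := by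
  obtain ⟨ha, hab, hbc, -, hc⟩ := h
  rintro ⟨p, q, s, t, h1, h2, h3, h4⟩
  obtain ⟨rfl, rfl⟩ : q = 0 ∧ s = 0 := by omega
  have hp : p < i + 1 := lt_of_mul_lt_mul_left (a := c) (by linarith) (by omega)
  have ht : t < l + 1 := lt_of_mul_lt_mul_left (a := c) (by linarith) (by omega)
  omega

theorem IsZeroExp.cancel (h : IsUpTriple a b c) {i j k l : ℕ} (hj : 0 < j)
    (hz : IsZeroExp a b c (i + 1) j k l) : IsZeroExp a b c i j k l := by
  rcases Nat.eq_zero_or_pos k with rfl | hk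
  swap
  · exact isZeroExp_of_pos h hj hk
  obtain ⟨ha, hab, hbc, -, hc⟩ := h
  obtain ⟨p, q, s, t, h1, h2, h3, h4⟩ := hz
  -- If the divisor contains `u₁`, cancel it. If not, it has at least `i + 1 + l + 1` factors `u₄`,
  -- and its `y`-degree is too large, since no generator other than `u₁` has a smaller `y`-degree
  -- than `u₂`.
  rcases p with _ | p
  · exfalso
    obtain ⟨e, he⟩ := Nat.exists_eq_add_of_lt (show q + s < j by omega)
    subst he
    have ht : t = i + 1 + l + (e + 1) := by omega
    subst ht
    nlinarith [Nat.zero_le ((b - a) * s), Nat.mul_le_mul_right s hab.le,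
      Nat.mul_le_mul_right (e + 1) (hab.trans hbc).le, Nat.zero_le (c * i)]
  · exact ⟨p, q, s, t, by omega, by omega, by linarith, by linarith⟩

theorem IsZeroExp.cancel_le (h : IsUpTriple a b c) {i j k l : ℕ} (hj : 0 < j)
    (hz : IsZeroExp a b c i j k l) : IsZeroExp a b c 0 j k l := by
  induction i with
  | zero => exact hz
  | succ i ih => exact ih (hz.cancel h hj)

theorem isZeroExp_pow (h : IsUpTriple a b c) : IsZeroExp a b c 0 c 0 0 := by
  obtain ⟨ha, hab, hbc, -, hc⟩ := h
  -- The divisor is `u₁ᵇ u₄ᶜ⁻ᵇ`, with the same `x`-degree; `c - b ≤ a` compares the `y`-degrees.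
  refine ⟨b, 0, 0, c - b, by omega, by omega, by linarith [mul_comm b c], ?_⟩
  have := Nat.mul_le_mul_left c (show c - b ≤ a by omega)
  linarith [mul_comm a c]

theorem symM_pos (h : IsUpTriple a b c) : 0 < symM a b c :=
  Nat.div_pos (Nat.gcd_le_left _ (by obtain ⟨_, _, _, _⟩ := h; omega))
    (Nat.gcd_pos_of_pos_left _ (by obtain ⟨_, _, _, _⟩ := h; omega))

theorem symL_pos (h : IsUpTriple a b c) : 0 < symL a b c :=
  Nat.div_pos (Nat.gcd_le_right _ (by obtain ⟨_, _, _, _⟩ := h; omega))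
    (Nat.gcd_pos_of_pos_left _ (by obtain ⟨_, _, _, _⟩ := h; omega))

theorem coprime_symM_symL (h : IsUpTriple a b c) : Nat.Coprime (symM a b c) (symL a b c) :=
  Nat.coprime_div_gcd_div_gcd (Nat.gcd_pos_of_pos_left _ (by obtain ⟨_, _, _, _⟩ := h; omega))

theorem mul_symM (h : IsUpTriple a b c) :
    b * symM a b c = c * symL a b c + a * symM a b c := by
  have h1 : symM a b c * Nat.gcd c (b - a) = c := Nat.div_mul_cancel (Nat.gcd_dvd_left _ _)
  have h2 : symL a b c * Nat.gcd c (b - a) = b - a := Nat.div_mul_cancel (Nat.gcd_dvd_right _ _)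
  obtain ⟨d, hd⟩ := Nat.exists_eq_add_of_le h.2.1.le
  have hd' : b - a = d := by omega
  generalize symM a b c = m at *
  generalize symL a b c = l at *
  generalize Nat.gcd c (b - a) = g at *
  rw [hd'] at h2
  subst hd h2
  rw [← h1]
  ring

theorem sameExp_binomial (h : IsUpTriple a b c) (i l : ℕ) :
    SameExp a b c (i + symL a b c) 0 (symM a b c) l i (symM a b c) 0 (l + symL a b c) := by
  have := mul_symM h
  exact ⟨by omega, by linarith, by linarith⟩

/-- By the binomial the monomial equals `u₂^m u₃ u₄^ℓ / u₁`, and `u₂u₃` is a proper multiple of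
`u₁u₄`; this yields the divisor `u₂^(m-1) u₄^(ℓ+1)`. -/
theorem isZeroExp_pred_symL (h : IsUpTriple a b c) :
    IsZeroExp a b c (symL a b c - 1) 0 (symM a b c + 1) 0 := by
  have h1 := mul_symM h
  have hm := symM_pos h
  have hl := symL_pos h
  obtain ⟨ha, hab, hbc, -, hc⟩ := h
  generalize symM a b c = m at *
  generalize symL a b c = l at *
  obtain ⟨m, rfl⟩ := Nat.exists_eq_add_of_lt hm
  obtain ⟨l, rfl⟩ := Nat.exists_eq_add_of_lt hl
  simp only [zero_add, Nat.add_sub_cancel] at *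
  exact ⟨0, m, 0, l + 1 + 1, by omega, by omega, by linarith, by linarith⟩

theorem SameExp.eq_of_zero_right (h : IsUpTriple a b c) {i j l i' j' l' : ℕ}
    (hs : SameExp a b c i j 0 l i' j' 0 l') : i = i' ∧ j = j' ∧ l = l' := by
  have hj := hs.add_eq h
  obtain ⟨h1, h2, h3⟩ := hs
  have hj' : j = j' := by omega
  subst hj'
  have hc : 0 < c := by obtain ⟨_, _, _, _⟩ := h; omega
  have : i = i' := Nat.eq_of_mul_eq_mul_left hc (by linarith)
  omega

theorem SameExp.exists_mul (h : IsUpTriple a b c) {i j l i' k' l' : ℕ}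
    (hs : SameExp a b c i j 0 l i' 0 k' l') :
    ∃ s, j = symM a b c * s ∧ k' = symM a b c * s ∧ i' = i + symL a b c * s ∧
      l = l' + symL a b c * s := by
  have hj := hs.add_eq h
  obtain ⟨h1, h2, h3⟩ := hs
  have hj' : j = k' := by omega
  subst hj'
  have hm := mul_symM h
  have hm0 := symM_pos h
  have hcop := coprime_symM_symL h
  generalize symM a b c = m at *
  generalize symL a b c = r at *
  have hc : 0 < c := by obtain ⟨_, _, _, _⟩ := h; omega
  have hab := h.2.1
  have hii : i ≤ i' := by
    by_contra! hlt
    nlinarith [Nat.mul_le_mul_right j hab.le]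
  obtain ⟨e, rfl⟩ := Nat.exists_eq_add_of_le hii
  -- The `x`-degrees give `(b - a) j = c e`; dividing by `gcd(c, b - a)` leaves a relation with
  -- coprime coefficients.
  have key : r * j = m * e := by
    apply Nat.eq_of_mul_eq_mul_left hc
    have h4 : b * j = c * e + a * j := by linarith
    have : b * m * j = c * r * j + a * m * j := by rw [hm]; ring
    have : b * j * m = c * e * m + a * j * m := by rw [h4]; ring
    linarith
  obtain ⟨s, rfl⟩ : m ∣ j := hcop.dvd_of_dvd_mul_left ⟨e, key⟩
  have : e = r * s := Nat.eq_of_mul_eq_mul_left hm0 (by rw [← key]; ring)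
  exact ⟨s, rfl, rfl, by rw [this], by omega⟩

/-- Applying the binomial to only one of the `s` copies leaves `z₂` and `z₃` side by side. -/
theorem isZeroExp_of_two_le (h : IsUpTriple a b c) {i l s : ℕ} (hs : 2 ≤ s) :
    IsZeroExp a b c (i + symL a b c * s) 0 (symM a b c * s) l := by
  obtain ⟨s, rfl⟩ := Nat.exists_eq_add_of_le hs
  have hm := mul_symM h
  have hm0 := symM_pos h
  have : IsZeroExp a b c (i + symL a b c * (1 + s)) (symM a b c) (symM a b c * (1 + s))
      (l + symL a b c) := isZeroExp_of_pos h hm0 (by positivity)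
  refine this.congr h ⟨by ring, by linarith, by linarith⟩

/-- Two different monomials with the same nonzero image in the fiber cone differ by the binomial. -/
theorem SameExp.eq_or_binomial (h : IsUpTriple a b c) {i j k l i' j' k' l' : ℕ}
    (hs : SameExp a b c i j k l i' j' k' l') (hz : ¬ IsZeroExp a b c i j k l) :
    (i = i' ∧ j = j' ∧ k = k' ∧ l = l') ∨
    (k = 0 ∧ j' = 0 ∧ j = symM a b c ∧ k' = symM a b c ∧ i' = i + symL a b c ∧
      l = l' + symL a b c) ∨
    (j = 0 ∧ k' = 0 ∧ k = symM a b c ∧ j' = symM a b c ∧ i = i' + symL a b c ∧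
      l' = l + symL a b c) := by
  have aux : ∀ {i j l i' k' l' : ℕ}, SameExp a b c i j 0 l i' 0 k' l' →
      ¬ IsZeroExp a b c i j 0 l → (i = i' ∧ j = 0 ∧ k' = 0 ∧ l = l') ∨
      (j = symM a b c ∧ k' = symM a b c ∧ i' = i + symL a b c ∧ l = l' + symL a b c) := by
    intro i j l i' k' l' hs hz
    obtain ⟨s, rfl, rfl, rfl, rfl⟩ := hs.exists_mul h
    rcases s with _ | _ | s
    · simp
    · simp
    · exact absurd ((isZeroExp_of_two_le h (by omega)).congr h hs.symm) hz
  have hz' : ¬ IsZeroExp a b c i' j' k' l' := fun H => hz (H.congr h hs.symm)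
  have h0 : j = 0 ∨ k = 0 := by
    by_contra! H
    exact hz (isZeroExp_of_pos h (by omega) (by omega))
  have h0' : j' = 0 ∨ k' = 0 := by
    by_contra! H
    exact hz' (isZeroExp_of_pos h (by omega) (by omega))
  rcases h0 with rfl | rfl <;> rcases h0' with rfl | rfl
  · have := hs.swap.eq_of_zero_right h
    omega
  · have := aux hs.symm hz'
    omega
  · have := aux hs hz
    omega
  · have := hs.eq_of_zero_right h
    omega

end UpTriple

/-! ### Powers of the ideal and the Rees algebra in terms of monomials. -/

/-- The exponent vector of the monomial `u ^ α` in `K[x, y]`. -/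
noncomputable def imageExp (a b c : ℕ) (α : Fin 4 →₀ ℕ) : Fin 2 →₀ ℕ :=
  Finsupp.single 0 (c * α 0 + b * α 1 + a * α 2) + Finsupp.single 1 (a * α 1 + b * α 2 + c * α 3)

theorem imageExp_zero_apply (a b c : ℕ) (α : Fin 4 →₀ ℕ) :
    imageExp a b c α 0 = c * α 0 + b * α 1 + a * α 2 := by simp [imageExp]

theorem imageExp_one_apply (a b c : ℕ) (α : Fin 4 →₀ ℕ) :
    imageExp a b c α 1 = a * α 1 + b * α 2 + c * α 3 := by simp [imageExp]

theorem imageExp_add (a b c : ℕ) (α β : Fin 4 →₀ ℕ) :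
    imageExp a b c (α + β) = imageExp a b c α + imageExp a b c β := by
  ext i
  fin_cases i
  · simp only [Fin.zero_eta, imageExp_zero_apply, Finsupp.add_apply]; ring
  · simp only [Fin.mk_one, imageExp_one_apply, Finsupp.add_apply]; ring

theorem symGen_eq_monomial (K : Type*) [Field K] (a b c : ℕ) (i : Fin 4) :
    symGen K a b c i = MvPolynomial.monomial (imageExp a b c (Finsupp.single i 1)) 1 := by
  fin_cases i <;>
  simp [symGen, imageExp, MvPolynomial.X_pow_eq_monomial, MvPolynomial.monomial_mul]

theorem sum_eq_degree (α : Fin 4 →₀ ℕ) : α 0 + α 1 + α 2 + α 3 = α.degree := by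
  simp [Finsupp.degree_eq_sum, Fin.sum_univ_four]

theorem symIdeal_pow (K : Type*) [Field K] (a b c n : ℕ) :
    symIdeal K a b c ^ n = Ideal.span ((fun s => MvPolynomial.monomial s (1 : K)) ''
      (imageExp a b c '' {α | α.degree = n})) := by
  induction n with
  | zero =>
    rw [pow_zero, Ideal.one_eq_top, eq_comm, Ideal.eq_top_iff_one]
    refine Ideal.subset_span ⟨0, ⟨0, by simp, ?_⟩, rfl⟩
    ext i
    fin_cases i <;> simp [imageExp]
  | succ n ih =>
    rw [pow_succ, ih, symIdeal, Ideal.span_mul_span']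
    congr 1
    ext p
    simp only [Set.mem_mul, Set.mem_image, Set.mem_ofPred_eq, Set.mem_range]
    constructor
    · rintro ⟨_, ⟨_, ⟨α, hα, rfl⟩, rfl⟩, _, ⟨i, rfl⟩, rfl⟩
      refine ⟨_, ⟨α + Finsupp.single i 1, by simp [hα], rfl⟩, ?_⟩
      rw [symGen_eq_monomial, MvPolynomial.monomial_mul, imageExp_add, mul_one]
    · rintro ⟨_, ⟨α, hα, rfl⟩, rfl⟩
      obtain ⟨i, hi⟩ : ∃ i, 1 ≤ α i := by
        by_contra! H
        have : α = 0 := by ext i; simpa using H i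
        simp [this] at hα
      have hle : Finsupp.single i 1 ≤ α := by simpa using hi
      have heq : α - Finsupp.single i 1 + Finsupp.single i 1 = α := tsub_add_cancel_of_le hle
      refine ⟨_, ⟨_, ⟨α - Finsupp.single i 1, ?_, rfl⟩, rfl⟩, _, ⟨i, rfl⟩, ?_⟩
      · have := congrArg Finsupp.degree heq
        simp only [map_add, Finsupp.degree_single, hα] at this
        omega
      · rw [symGen_eq_monomial, MvPolynomial.monomial_mul, ← imageExp_add, heq, mul_one]

theorem maxIdealXY_mul_symIdeal_pow (K : Type*) [Field K] (a b c n : ℕ) :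
    maxIdealXY K * symIdeal K a b c ^ n = Ideal.span ((fun s => MvPolynomial.monomial s (1 : K)) ''
      {s | ∃ (i : Fin 2) (α : Fin 4 →₀ ℕ), α.degree = n ∧
        s = Finsupp.single i 1 + imageExp a b c α}) := by
  rw [symIdeal_pow, maxIdealXY, Ideal.span_mul_span']
  congr 1
  ext p
  simp only [Set.mem_mul, Set.mem_image, Set.mem_ofPred_eq, Set.mem_insert_iff,
    Set.mem_singleton_iff]
  constructor
  · rintro ⟨_, (rfl | rfl), _, ⟨_, ⟨α, hα, rfl⟩, rfl⟩, rfl⟩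
    · exact ⟨_, ⟨0, α, hα, rfl⟩, by simp [MvPolynomial.X, MvPolynomial.monomial_mul]⟩
    · exact ⟨_, ⟨1, α, hα, rfl⟩, by simp [MvPolynomial.X, MvPolynomial.monomial_mul]⟩
  · rintro ⟨_, ⟨i, α, hα, rfl⟩, rfl⟩
    refine ⟨MvPolynomial.X i, ?_, _, ⟨_, ⟨α, hα, rfl⟩, rfl⟩, by
      simp [MvPolynomial.X, MvPolynomial.monomial_mul]⟩
    fin_cases i <;> simp

/-- An element of the Rees algebra lies in `𝔪 R(I)` if and only if its `n`-th coefficient lies in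
`𝔪 Iⁿ` for all `n`. -/
theorem mem_map_algebraMap_reesAlgebra_iff {S : Type*} [CommRing S] (𝔪 I : Ideal S)
    (f : reesAlgebra I) :
    f ∈ 𝔪.map (algebraMap S (reesAlgebra I)) ↔ ∀ n, (f : Polynomial S).coeff n ∈ 𝔪 * I ^ n := by
  constructor
  · intro hf
    refine Submodule.span_induction (p := fun x _ => ∀ n,
      ((x : reesAlgebra I) : Polynomial S).coeff n ∈ 𝔪 * I ^ n) ?_ ?_ ?_ ?_ hf
    · rintro _ ⟨s, hs, rfl⟩ n
      have : ((algebraMap S (reesAlgebra I) s : reesAlgebra I) : Polynomial S) =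
        Polynomial.C s := rfl
      rw [this, Polynomial.coeff_C]
      split_ifs with h
      · subst h
        simpa using hs
      · exact zero_mem _
    · simp
    · intro x y _ _ hx hy n
      simpa using add_mem (hx n) (hy n)
    · intro r x _ hx n
      rw [smul_eq_mul, MulMemClass.coe_mul, Polynomial.coeff_mul]
      refine Ideal.sum_mem _ ?_
      rintro ⟨i, j⟩ hij
      rw [← Finset.HasAntidiagonal.mem_antidiagonal.mp hij, pow_add, mul_left_comm]
      exact Ideal.mul_mem_mul (r.2 i) (hx j)
  · intro hf
    have key : ∀ n c, c ∈ 𝔪 * I ^ n → ∃ x ∈ 𝔪.map (algebraMap S (reesAlgebra I)),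
        (x : Polynomial S) = Polynomial.monomial n c := by
      intro n c hc
      refine Submodule.mul_induction_on hc ?_ ?_
      · intro r hr s hs
        refine ⟨algebraMap S (reesAlgebra I) r *
          ⟨Polynomial.monomial n s, reesAlgebra.monomial_mem.mpr hs⟩,
          Ideal.mul_mem_right _ _ (Ideal.mem_map_of_mem _ hr), ?_⟩
        change Polynomial.C r * Polynomial.monomial n s = Polynomial.monomial n (r * s)
        rw [Polynomial.C_mul_monomial]
      · rintro x y ⟨x', hx, hx'⟩ ⟨y', hy, hy'⟩
        refine ⟨x' + y', add_mem hx hy, ?_⟩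
        rw [Subalgebra.coe_add, hx', hy', map_add]
    choose g hg hg' using fun n => key n _ (hf n)
    have : f = ∑ n ∈ (f : Polynomial S).support, g n := by
      refine Subtype.ext ?_
      rw [AddSubmonoidClass.coe_finsetSum]
      simp only [hg']
      exact (f : Polynomial S).as_sum_support
    rw [this]
    exact Ideal.sum_mem _ fun n _ => hg n

/-- The canonical map from `K[z₁, …, z₄]` to the Rees algebra. -/
noncomputable def toRees (K : Type*) [Field K] (a b c : ℕ) :
    MvPolynomial (Fin 4) K →ₐ[K] reesAlgebra (symIdeal K a b c) :=
  MvPolynomial.aeval fun i => ⟨Polynomial.monomial 1 (symGen K a b c i),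
    reesAlgebra.monomial_mem.mpr (by
      rw [pow_one]
      exact Ideal.subset_span (Set.mem_range_self i))⟩

theorem symFiberMap_eq (K : Type*) [Field K] (a b c : ℕ) (p : MvPolynomial (Fin 4) K) :
    symFiberMap K a b c p = Ideal.Quotient.mk _ (toRees K a b c p) := by
  have : symFiberMap K a b c = (Ideal.Quotient.mkₐ K _).comp (toRees K a b c) := by
    ext i
    simp [symFiberMap, toRees, fiberConeOf]
  rw [this]
  rfl

theorem toRees_monomial (K : Type*) [Field K] (a b c : ℕ) (α : Fin 4 →₀ ℕ) (r : K) :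
    (toRees K a b c (MvPolynomial.monomial α r) : Polynomial (MvPolynomial (Fin 2) K)) =
      Polynomial.monomial α.degree (MvPolynomial.monomial (imageExp a b c α) r) := by
  have hX : ∀ i, (toRees K a b c (MvPolynomial.X i) : Polynomial (MvPolynomial (Fin 2) K)) =
      Polynomial.monomial 1 (MvPolynomial.monomial (imageExp a b c (Finsupp.single i 1)) 1) := by
    intro i
    rw [← symGen_eq_monomial, toRees, MvPolynomial.aeval_X]
  have hC : (toRees K a b c (MvPolynomial.C r) : Polynomial (MvPolynomial (Fin 2) K)) =
      Polynomial.C (MvPolynomial.C r) := by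
    rw [← MvPolynomial.algebraMap_eq, AlgHom.commutes]
    rfl
  rw [MvPolynomial.monomial_eq, Finsupp.prod_fintype _ _ (by simp), Fin.prod_univ_four]
  simp only [map_mul, map_pow, MulMemClass.coe_mul, SubmonoidClass.coe_pow, hX, hC,
    Polynomial.monomial_pow, MvPolynomial.monomial_pow, Polynomial.monomial_mul_monomial,
    MvPolynomial.monomial_mul, Polynomial.C_mul_monomial, MvPolynomial.C_mul_monomial, one_pow,
    mul_one, one_mul, sum_eq_degree]
  have hE : α 0 • imageExp a b c (Finsupp.single 0 1) + α 1 • imageExp a b c (Finsupp.single 1 1) +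
      α 2 • imageExp a b c (Finsupp.single 2 1) + α 3 • imageExp a b c (Finsupp.single 3 1) =
      imageExp a b c α := by
    ext i
    fin_cases i
    · simp [imageExp_zero_apply]
      ring
    · simp [imageExp_one_apply]
      ring
  rw [hE]

theorem toRees_coeff (K : Type*) [Field K] (a b c : ℕ) (p : MvPolynomial (Fin 4) K) (n : ℕ)
    (δ : Fin 2 →₀ ℕ) :
    ((toRees K a b c p : Polynomial (MvPolynomial (Fin 2) K)).coeff n).coeff δ =
      ∑ α ∈ p.support with α.degree = n ∧ imageExp a b c α = δ, p.coeff α := by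
  conv_lhs => rw [p.as_sum]
  rw [map_sum, AddSubmonoidClass.coe_finsetSum, Polynomial.finsetSum_coeff,
    MvPolynomial.coeff_sum, Finset.sum_filter]
  refine Finset.sum_congr rfl fun α _ => ?_
  rw [toRees_monomial, Polynomial.coeff_monomial]
  split_ifs with h1 h2 h2
  · rw [MvPolynomial.coeff_monomial, if_pos h2.2]
  · rw [MvPolynomial.coeff_monomial, if_neg (by tauto)]
  · tauto
  · simp

/-! ### Membership in `J` and its generators. -/

/-- The exponents of the monomials which vanish in the fiber cone. -/
def zeroSet (a b c : ℕ) : Set (Fin 4 →₀ ℕ) :=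
  {α | IsZeroExp a b c (α 0) (α 1) (α 2) (α 3)}

/-- Two monomials of the same degree in `z₁, …, z₄` have the same image in `K[x, y]`. -/
def SameImage (a b c : ℕ) (α β : Fin 4 →₀ ℕ) : Prop :=
  SameExp a b c (α 0) (α 1) (α 2) (α 3) (β 0) (β 1) (β 2) (β 3)

theorem sameImage_iff (a b c : ℕ) (α β : Fin 4 →₀ ℕ) :
    SameImage a b c α β ↔ α.degree = β.degree ∧ imageExp a b c α = imageExp a b c β := by
  rw [← sum_eq_degree, ← sum_eq_degree, Finsupp.ext_iff, Fin.forall_fin_two]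
  simp only [imageExp_zero_apply, imageExp_one_apply, SameImage, SameExp]

theorem mem_zeroSet_iff {a b c : ℕ} (h : IsUpTriple a b c) (α : Fin 4 →₀ ℕ) :
    α ∈ zeroSet a b c ↔ ∃ (i : Fin 2) (β : Fin 4 →₀ ℕ), β.degree = α.degree ∧
      Finsupp.single i 1 + imageExp a b c β ≤ imageExp a b c α := by
  have hsum : ∀ β : Fin 4 →₀ ℕ, imageExp a b c β 0 + imageExp a b c β 1 =
      c * β.degree + (a + b - c) * (β 1 + β 2) := by
    intro β
    obtain ⟨d, hd⟩ := Nat.exists_eq_add_of_le h.2.2.2.2.le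
    rw [imageExp_zero_apply, imageExp_one_apply, ← sum_eq_degree, hd, Nat.add_sub_cancel_left]
    linear_combination (β 1 + β 2) * hd
  have hd : 0 < a + b - c := by
    have := h.2.2.2.2
    omega
  have hα := hsum α
  constructor
  · rintro ⟨p, q, s, t, h1, h2, h3, h4⟩
    set β : Fin 4 →₀ ℕ := Finsupp.equivFunOnFinite.symm ![p, q, s, t] with hβ
    have e0 : β 0 = p := rfl
    have e1 : β 1 = q := rfl
    have e2 : β 2 = s := rfl
    have e3 : β 3 = t := rfl
    have hdeg : β.degree = α.degree := by
      rw [← sum_eq_degree, ← sum_eq_degree, e0, e1, e2, e3, h1]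
    have hβs := hsum β
    rw [hdeg, e1, e2] at hβs
    have hlt := Nat.mul_lt_mul_of_pos_left h2 hd
    have h0 : imageExp a b c β 0 ≤ imageExp a b c α 0 := by
      rw [imageExp_zero_apply, imageExp_zero_apply]
      exact h3
    have h1' : imageExp a b c β 1 ≤ imageExp a b c α 1 := by
      rw [imageExp_one_apply, imageExp_one_apply]
      exact h4
    -- The total degree drops strictly, so at least one coordinate does; it decides whether `x` or
    -- `y` can be split off.
    rcases lt_or_ge (imageExp a b c β 0) (imageExp a b c α 0) with hl | hl
    · refine ⟨0, β, hdeg, ?_⟩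
      rw [Finsupp.le_def, Fin.forall_fin_two]
      simp
      omega
    · refine ⟨1, β, hdeg, ?_⟩
      rw [Finsupp.le_def, Fin.forall_fin_two]
      simp
      omega
  · rintro ⟨i, β, hdeg, hle⟩
    have hβs := hsum β
    rw [Finsupp.le_def, Fin.forall_fin_two] at hle
    simp only [Finsupp.add_apply] at hle
    have hi : (Finsupp.single i 1 : Fin 2 →₀ ℕ) 0 + (Finsupp.single i 1 : Fin 2 →₀ ℕ) 1 = 1 := by
      fin_cases i <;> simp
    rw [hdeg] at hβs
    refine ⟨β 0, β 1, β 2, β 3, by rw [sum_eq_degree, sum_eq_degree, hdeg], ?_, ?_, ?_⟩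
    · exact lt_of_mul_lt_mul_left (a := a + b - c) (by omega) (by omega)
    · rw [← imageExp_zero_apply, ← imageExp_zero_apply]
      omega
    · rw [← imageExp_one_apply, ← imageExp_one_apply]
      omega

open Classical in
/-- Membership in the defining ideal of the fiber cone in terms of coefficients. -/
theorem mem_symDefIdeal_iff (K : Type*) [Field K] {a b c : ℕ} (h : IsUpTriple a b c)
    (p : MvPolynomial (Fin 4) K) :
    p ∈ symDefIdeal K a b c ↔ ∀ α ∉ zeroSet a b c,
      ∑ β ∈ p.support with SameImage a b c β α, p.coeff β = 0 := by
  have hker : p ∈ symDefIdeal K a b c ↔ ∀ n, ((toRees K a b c p :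
      Polynomial (MvPolynomial (Fin 2) K)).coeff n) ∈ maxIdealXY K * symIdeal K a b c ^ n := by
    rw [← mem_map_algebraMap_reesAlgebra_iff, symDefIdeal, RingHom.mem_ker, symFiberMap_eq,
      Ideal.Quotient.eq_zero_iff_mem]
  have hsame : ∀ α, ∑ β ∈ p.support with SameImage a b c β α, p.coeff β =
      ((toRees K a b c p : Polynomial (MvPolynomial (Fin 2) K)).coeff α.degree).coeff
        (imageExp a b c α) := by
    intro α
    rw [toRees_coeff]
    simp only [sameImage_iff]
  rw [hker]
  simp only [maxIdealXY_mul_symIdeal_pow, MvPolynomial.mem_ideal_span_monomial_image,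
    MvPolynomial.mem_support_iff]
  constructor
  · intro H α hα
    rw [hsame]
    by_contra hne
    obtain ⟨_, ⟨i, β, hβ, rfl⟩, hle⟩ := H _ _ hne
    exact hα ((mem_zeroSet_iff h α).mpr ⟨i, β, hβ, hle⟩)
  · intro H n δ hne
    have hne' := hne
    rw [toRees_coeff] at hne
    obtain ⟨α, hα, -⟩ := Finset.exists_ne_zero_of_sum_ne_zero hne
    obtain ⟨-, rfl, rfl⟩ := Finset.mem_filter.mp hα
    have : α ∈ zeroSet a b c := by
      by_contra hα'
      exact hne' (hsame α ▸ H α hα')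
    obtain ⟨i, β, hβ, hle⟩ := (mem_zeroSet_iff h α).mp this
    exact ⟨_, ⟨i, β, hβ, rfl⟩, hle⟩

open MvPolynomial

/-- The exponent vector `(i, j, k, l)`. -/
noncomputable def expVec (i j k l : ℕ) : Fin 4 →₀ ℕ := Finsupp.equivFunOnFinite.symm ![i, j, k, l]

@[simp] theorem expVec_zero (i j k l : ℕ) : expVec i j k l 0 = i := rfl
@[simp] theorem expVec_one (i j k l : ℕ) : expVec i j k l 1 = j := rfl
@[simp] theorem expVec_two (i j k l : ℕ) : expVec i j k l 2 = k := rfl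
@[simp] theorem expVec_three (i j k l : ℕ) : expVec i j k l 3 = l := rfl

theorem exp_ext_iff {α β : Fin 4 →₀ ℕ} :
    α = β ↔ α 0 = β 0 ∧ α 1 = β 1 ∧ α 2 = β 2 ∧ α 3 = β 3 := by
  rw [Finsupp.ext_iff]
  simp [Fin.forall_fin_succ]

theorem exp_le_iff {α β : Fin 4 →₀ ℕ} :
    α ≤ β ↔ α 0 ≤ β 0 ∧ α 1 ≤ β 1 ∧ α 2 ≤ β 2 ∧ α 3 ≤ β 3 := by
  rw [Finsupp.le_def]
  simp [Fin.forall_fin_succ]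

theorem expVec_eta (α : Fin 4 →₀ ℕ) : expVec (α 0) (α 1) (α 2) (α 3) = α := by
  simp [exp_ext_iff]

theorem monomial_expVec (K : Type*) [Field K] (i j k l : ℕ) :
    (monomial (expVec i j k l) 1 : MvPolynomial (Fin 4) K) = X 0 ^ i * X 1 ^ j * X 2 ^ k * X 3 ^ l := by
  rw [MvPolynomial.monomial_eq, Finsupp.prod_fintype _ _ (by simp), Fin.prod_univ_four]
  simp

theorem isUpperSet_zeroSet (a b c : ℕ) : IsUpperSet (zeroSet a b c) := by
  intro α β hle hα
  rw [exp_le_iff] at hle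
  exact IsZeroExp.mono hα hle.1 hle.2.1 hle.2.2.1 hle.2.2.2

theorem symBinomial_eq (K : Type*) [Field K] (a b c : ℕ) : symBinomial K a b c =
    monomial (expVec (symL a b c) 0 (symM a b c) 0) 1 -
      monomial (expVec 0 (symM a b c) 0 (symL a b c)) 1 := by
  simp [monomial_expVec, symBinomial]

section

variable (K : Type*) [Field K] {a b c : ℕ}

theorem symFiberMap_monomial_eq {α β : Fin 4 →₀ ℕ} (hs : SameImage a b c α β) (r : K) :
    symFiberMap K a b c (monomial α r) = symFiberMap K a b c (monomial β r) := by
  rw [symFiberMap_eq, symFiberMap_eq]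
  congr 1
  refine Subtype.ext ?_
  obtain ⟨h1, h2⟩ := (sameImage_iff a b c α β).mp hs
  rw [toRees_monomial, toRees_monomial, h1, h2]

theorem monomial_sub_monomial_mem {α β : Fin 4 →₀ ℕ} (hs : SameImage a b c α β) (r : K) :
    monomial α r - monomial β r ∈ symDefIdeal K a b c := by
  rw [symDefIdeal, RingHom.mem_ker, map_sub, symFiberMap_monomial_eq K hs, sub_self]

theorem monomial_mem_symDefIdeal (h : IsUpTriple a b c) {α : Fin 4 →₀ ℕ} (hα : α ∈ zeroSet a b c)
    (r : K) : monomial α r ∈ symDefIdeal K a b c := by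
  classical
  rw [mem_symDefIdeal_iff K h]
  intro β hβ
  refine Finset.sum_eq_zero fun γ hγ => ?_
  obtain ⟨-, hγ⟩ := Finset.mem_filter.mp hγ
  rw [coeff_monomial, if_neg]
  rintro rfl
  exact hβ (IsZeroExp.congr h hα hγ)

theorem coeff_eq_zero_of_mem_symDefIdeal (h : IsUpTriple a b c) {p : MvPolynomial (Fin 4) K}
    (hp : p ∈ symDefIdeal K a b c) {α : Fin 4 →₀ ℕ} (hα : α ∉ zeroSet a b c)
    (hs : ∀ β ∈ p.support, SameImage a b c β α → β = α) : p.coeff α = 0 := by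
  classical
  by_contra hne
  apply hne
  rw [← (mem_symDefIdeal_iff K h p).mp hp α hα, Finset.sum_eq_single α]
  · intro β hβ hne'
    obtain ⟨h1, h2⟩ := Finset.mem_filter.mp hβ
    exact absurd (hs β h1 h2) hne'
  · intro hα'
    exact absurd (Finset.mem_filter.mpr ⟨mem_support_iff.mpr hne, rfl, rfl, rfl⟩) hα'

theorem symBinomial_mem : IsUpTriple a b c → symBinomial K a b c ∈ symDefIdeal K a b c := by
  intro h
  rw [symBinomial_eq]
  refine monomial_sub_monomial_mem K ?_ 1
  have := sameExp_binomial h 0 0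
  simpa [SameImage] using this

theorem SameImage.monomial_sub_mem_span (h : IsUpTriple a b c) {α β : Fin 4 →₀ ℕ}
    (hs : SameImage a b c α β) (hα : α ∉ zeroSet a b c) :
    (monomial α 1 - monomial β 1 : MvPolynomial (Fin 4) K) ∈ Ideal.span {symBinomial K a b c} := by
  rw [← expVec_eta α, ← expVec_eta β, monomial_expVec, monomial_expVec, Ideal.mem_span_singleton,
    symBinomial]
  rcases hs.eq_or_binomial h hα with ⟨h1, h2, h3, h4⟩ | ⟨h1, h2, h3, h4, h5, h6⟩ |
    ⟨h1, h2, h3, h4, h5, h6⟩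
  · simp [h1, h2, h3, h4]
  · rw [h1, h2, h3, h4, h5, h6]
    exact ⟨-(X 0 ^ α 0 * X 3 ^ β 3), by ring⟩
  · rw [h1, h2, h3, h4, h5, h6]
    exact ⟨X 0 ^ β 0 * X 3 ^ α 3, by ring⟩

/-- Modulo `G` a monomial depends only on its degree and its image, so `p` collapses to one term per
class, whose coefficient is zero or whose monomials all lie in `G`. -/
theorem symDefIdeal_le (h : IsUpTriple a b c) {G : Ideal (MvPolynomial (Fin 4) K)}
    (hG : ∀ α ∈ zeroSet a b c, monomial α 1 ∈ G) (hf : symBinomial K a b c ∈ G) :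
    symDefIdeal K a b c ≤ G := by
  classical
  intro p hp
  let key : (Fin 4 →₀ ℕ) → ℕ × (Fin 2 →₀ ℕ) := fun α => (α.degree, imageExp a b c α)
  have hkey : ∀ α β, key α = key β ↔ SameImage a b c α β := by
    intro α β
    rw [sameImage_iff, Prod.ext_iff]
  -- `S` sends a class to the residue of a chosen nonvanishing representative. The default `0` is
  -- consistent, since all monomials of such a class lie in `G`.
  have hS : ∃ S : ℕ × (Fin 2 →₀ ℕ) → MvPolynomial (Fin 4) K ⧸ G,
      (∀ α, Ideal.Quotient.mk G (monomial α 1) = S (key α)) ∧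
      ∀ e, (∀ α, key α = e → α ∈ zeroSet a b c) → S e = 0 := by
    refine ⟨fun e => if H : ∃ α ∉ zeroSet a b c, key α = e then
      Ideal.Quotient.mk G (monomial H.choose 1) else 0, fun α => ?_, fun e he => ?_⟩
    · dsimp only
      split_ifs with H
      · obtain ⟨h1, h2⟩ := H.choose_spec
        rw [Ideal.Quotient.eq]
        have hle : Ideal.span {symBinomial K a b c} ≤ G := by
          rwa [Ideal.span_singleton_le_iff_mem]
        have := hle (((hkey _ _).mp h2).monomial_sub_mem_span K h h1)
        rw [← neg_mem_iff, neg_sub]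
        exact this
      · rw [Ideal.Quotient.eq_zero_iff_mem]
        push Not at H
        refine hG α ?_
        by_contra hα
        exact H α hα rfl
    · dsimp only
      rw [dif_neg]
      rintro ⟨α, hα, hα'⟩
      exact hα (he α hα')
  obtain ⟨S, hS1, hS2⟩ := hS
  rw [← Ideal.Quotient.eq_zero_iff_mem, p.as_sum, map_sum]
  have hmon : ∀ α, Ideal.Quotient.mk G (monomial α (coeff α p)) =
      Ideal.Quotient.mk G (C (coeff α p)) * S (key α) := by
    intro α
    rw [← hS1, ← map_mul, C_mul_monomial, mul_one]
  simp only [hmon]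
  rw [← Finset.sum_fiberwise_of_maps_to (t := p.support.image key) (g := key)
    (fun α hα => Finset.mem_image_of_mem _ hα)]
  refine Finset.sum_eq_zero fun e _ => ?_
  have : ∑ α ∈ p.support with key α = e, Ideal.Quotient.mk G (C (coeff α p)) * S (key α) =
      Ideal.Quotient.mk G (C (∑ α ∈ p.support with key α = e, coeff α p)) * S e := by
    rw [map_sum, map_sum, Finset.sum_mul]
    refine Finset.sum_congr rfl fun α hα => ?_
    rw [(Finset.mem_filter.mp hα).2]
  rw [this]
  by_cases H : ∀ α, key α = e → α ∈ zeroSet a b c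
  · rw [hS2 e H, mul_zero]
  · push Not at H
    obtain ⟨α, rfl, hα⟩ := H
    have := (mem_symDefIdeal_iff K h p).mp hp α hα
    simp only [hkey]
    rw [this]
    simp

end

/-! ### Nonzerodivisors modulo monomial ideals, and modulo `J` via `J : z₂` and `J + (z₂)`. -/

section Regular

variable {K σ : Type*} [Field K]

/-- If the exponents in the upper set `S` do not depend on the `i`-th coordinate, then
`Xᵢ + r Xⱼ` is a nonzerodivisor modulo the monomial ideal given by `S`. -/
theorem mem_of_X_add_mul_mem {i j : σ} (hij : i ≠ j) (r : K) {S : Set (σ →₀ ℕ)} (hS : IsUpperSet S)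
    (hi : ∀ α, α + Finsupp.single i 1 ∈ S → α ∈ S) {g : MvPolynomial σ K}
    (hg : ∀ α ∈ ((X i + C r * X j) * g).support, α ∈ S) : ∀ α ∈ g.support, α ∈ S := by
  classical
  by_contra! H
  obtain ⟨α₀, hα₀, hα₀S⟩ := H
  -- Among the exponents of `g` outside `S`, one with the largest `i`-th coordinate cannot cancel: a
  -- competing term from `r Xⱼ` would have a larger `i`-th coordinate.
  obtain ⟨α, hα, hmax⟩ := Finset.exists_max_image (g.support.filter (· ∉ S)) (fun α => α i)
    ⟨α₀, Finset.mem_filter.mpr ⟨hα₀, hα₀S⟩⟩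
  obtain ⟨hα, hαS⟩ := Finset.mem_filter.mp hα
  refine hαS (hi _ (hg _ ?_))
  rw [mem_support_iff, add_mul, mul_assoc, coeff_add, coeff_C_mul, add_comm α, coeff_X_mul,
    coeff_X_mul']
  have hz : (if j ∈ (Finsupp.single i 1 + α).support then
      coeff (Finsupp.single i 1 + α - Finsupp.single j 1) g else 0) = 0 := by
    split_ifs with hj
    · by_contra hne
      set β := Finsupp.single i 1 + α - Finsupp.single j 1 with hβ
      have hle : Finsupp.single j 1 ≤ Finsupp.single i 1 + α := by
        simpa [Nat.one_le_iff_ne_zero] using hj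
      have hβα : β + Finsupp.single j 1 = Finsupp.single i 1 + α := tsub_add_cancel_of_le hle
      have hβS : β ∉ S := by
        intro hβS
        refine hαS (hi _ ?_)
        rw [add_comm, ← hβα]
        exact hS le_self_add hβS
      have h1 := hmax β (Finset.mem_filter.mpr ⟨mem_support_iff.mpr hne, hβS⟩)
      have h2 := DFunLike.congr_fun hβα i
      simp only [Finsupp.add_apply, Finsupp.single_eq_same, Finsupp.single_apply, hij.symm,
        if_false] at h2
      omega
    · rfl
  rw [hz, mul_zero, add_zero]
  exact mem_support_iff.mp hα

end Regular

/-- The exponents of the monomials in `J : z₂`. -/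
def colonSet (a b c : ℕ) : Set (Fin 4 →₀ ℕ) := {α | α + Finsupp.single 1 1 ∈ zeroSet a b c}

/-- The exponents of the monomials in `J + (z₂)`. -/
def sumSet (a b c : ℕ) : Set (Fin 4 →₀ ℕ) :=
  {α | 0 < α 1 ∨ α ∈ zeroSet a b c ∨ (symL a b c ≤ α 0 ∧ symM a b c ≤ α 2)}

theorem isUpperSet_colonSet (a b c : ℕ) : IsUpperSet (colonSet a b c) :=
  fun _ _ hle hα => isUpperSet_zeroSet a b c (add_le_add_left hle _) hα

theorem isUpperSet_sumSet (a b c : ℕ) : IsUpperSet (sumSet a b c) := by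
  intro α β hle hα
  have h := exp_le_iff.mp hle
  rcases hα with hα | hα | hα
  · exact Or.inl (by omega)
  · exact Or.inr (Or.inl (isUpperSet_zeroSet a b c hle hα))
  · exact Or.inr (Or.inr (by omega))

/-- The monomials `z₁ⁱz₃ᵏ` vanish in the fiber cone only if `z₃ᵏ` does. -/
def NoMixed (a b c : ℕ) : Prop := ∀ i k, IsZeroExp a b c i 0 k 0 → IsZeroExp a b c 0 0 k 0

section

variable {a b c : ℕ} (h : IsUpTriple a b c)
include h

theorem colonSet_cancel_zero (α : Fin 4 →₀ ℕ)
    (hα : α + Finsupp.single 0 1 ∈ colonSet a b c) : α ∈ colonSet a b c := by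
  simp only [colonSet, zeroSet, Set.mem_ofPred_eq, Finsupp.add_apply, Finsupp.single_apply] at *
  simp at *
  exact hα.cancel h (by omega)

theorem colonSet_cancel_three (hP : NoMixed a b c) (α : Fin 4 →₀ ℕ)
    (hα : α + Finsupp.single 3 1 ∈ colonSet a b c) : α ∈ colonSet a b c := by
  simp only [colonSet, zeroSet, Set.mem_ofPred_eq, Finsupp.add_apply, Finsupp.single_apply] at *
  simp at *
  rcases Nat.eq_zero_or_pos (α 2) with h2 | h2
  · rw [h2] at hα ⊢
    have := (hP _ _ (hα.cancel_le h (by omega)).symm).symm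
    exact this.mono (by omega) (by omega) (by omega) (by omega)
  · exact isZeroExp_of_pos h (by omega) h2

theorem sumSet_cancel_three (α : Fin 4 →₀ ℕ)
    (hα : α + Finsupp.single 3 1 ∈ sumSet a b c) : α ∈ sumSet a b c := by
  simp only [sumSet, zeroSet, Set.mem_ofPred_eq, Finsupp.add_apply, Finsupp.single_apply] at *
  simp at *
  rcases hα with hα | hα | hα
  · exact Or.inl hα
  · rcases Nat.eq_zero_or_pos (α 1) with h1 | h1
    · right; left
      rcases Nat.eq_zero_or_pos (α 2) with h2 | h2
      · rw [h1, h2] at hα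
        exact absurd hα not_isZeroExp_pure
      · exact (hα.symm.cancel h h2).symm
    · exact Or.inl h1
  · exact Or.inr (Or.inr hα)

variable {K : Type*} [Field K]

theorem mem_symDefIdeal_of_support {g : MvPolynomial (Fin 4) K}
    (hg : ∀ α ∈ g.support, α ∈ zeroSet a b c) : g ∈ symDefIdeal K a b c := by
  rw [g.as_sum]
  exact Ideal.sum_mem _ fun α hα => monomial_mem_symDefIdeal K h (hg α hα) _

/-- Two different surviving monomials with equal image are never both divisible by `z₂`, so no
cancellation occurs and membership is tested monomial by monomial. -/
theorem X_one_mul_mem_iff {g : MvPolynomial (Fin 4) K} :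
    X 1 * g ∈ symDefIdeal K a b c ↔ ∀ α ∈ g.support, α ∈ colonSet a b c := by
  classical
  constructor
  · intro hg α hα
    by_contra hα'
    have := coeff_eq_zero_of_mem_symDefIdeal K h hg hα' ?_
    · rw [add_comm, coeff_X_mul] at this
      exact mem_support_iff.mp hα this
    · intro β hβ hs
      have hβz : β ∉ zeroSet a b c := fun H => hα' (IsZeroExp.congr h H hs)
      rw [mem_support_iff, coeff_X_mul'] at hβ
      have hβ1 : 0 < β 1 := by
        by_contra H
        rw [if_neg (by simpa using H)] at hβ
        exact hβ rfl
      rcases hs.eq_or_binomial h hβz with H | H | H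
      · exact exp_ext_iff.mpr H
      · simp at H
      · omega
  · intro hg
    apply mem_symDefIdeal_of_support h
    intro α hα
    rw [mem_support_iff, coeff_X_mul'] at hα
    split_ifs at hα with h1
    · have := hg _ (mem_support_iff.mpr hα)
      have hle : Finsupp.single 1 1 ≤ α := by
        simpa [Nat.one_le_iff_ne_zero] using h1
      rw [colonSet, Set.mem_ofPred_eq, tsub_add_cancel_of_le hle] at this
      exact this
    · exact absurd rfl hα

/-- Outside this set a monomial is alone in its class: a partner would require divisibility by `z₂`
or by `z₁^ℓ z₃^m`. -/
theorem support_subset_sumSet {g : MvPolynomial (Fin 4) K} (hg : g ∈ symDefIdeal K a b c) :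
    ∀ α ∈ g.support, α ∈ sumSet a b c := by
  intro α hα
  by_contra H
  simp only [sumSet, Set.mem_ofPred_eq, not_or] at H
  obtain ⟨h1, h2, h3⟩ := H
  refine mem_support_iff.mp hα (coeff_eq_zero_of_mem_symDefIdeal K h hg h2 fun β hβ hs => ?_)
  have hβz : β ∉ zeroSet a b c := fun H => h2 (IsZeroExp.congr h H hs)
  rcases hs.eq_or_binomial h hβz with H | H | H
  · exact exp_ext_iff.mpr H
  · omega
  · have := symM_pos h
    omega

theorem exists_sub_X_one_mul_mem {g : MvPolynomial (Fin 4) K}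
    (hg : ∀ α ∈ g.support, α ∈ sumSet a b c) : ∃ q, g - X 1 * q ∈ symDefIdeal K a b c := by
  have hmem : g ∈ symDefIdeal K a b c ⊔ Ideal.span {X 1} := by
    have hX : ∀ (α : Fin 4 →₀ ℕ) (r : K), 0 < α 1 →
        monomial α r ∈ symDefIdeal K a b c ⊔ Ideal.span {X 1} := by
      intro α r hα
      refine Ideal.mem_sup_right (Ideal.mem_span_singleton.mpr ?_)
      rw [X_dvd_monomial]
      exact Or.inr hα.ne'
    rw [g.as_sum]
    refine Ideal.sum_mem _ fun α hα => ?_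
    rcases hg α hα with h1 | h1 | ⟨h1, h2⟩
    · exact hX _ _ h1
    · exact Ideal.mem_sup_left (monomial_mem_symDefIdeal K h h1 _)
    · rcases Nat.eq_zero_or_pos (α 1) with h3 | h3
      swap
      · exact hX _ _ h3
      obtain ⟨i, hi⟩ := Nat.exists_eq_add_of_le' h1
      obtain ⟨k, hk⟩ := Nat.exists_eq_add_of_le' h2
      have hm := symM_pos h
      -- The binomial turns `z₁^ℓ z₃^m` into a multiple of `z₂`; if a factor `z₃` remains, `z₂z₃`
      -- appears and the monomial lies in `J` itself.
      rcases Nat.eq_zero_or_pos k with rfl | hk0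
      · have hs : SameImage a b c α (expVec i (symM a b c) 0 (α 3 + symL a b c)) := by
          have := sameExp_binomial h i (α 3)
          rw [SameImage, hi, hk, h3, zero_add]
          exact this
        have h4 := Ideal.mem_sup_left (T := Ideal.span {X 1})
          (monomial_sub_monomial_mem K hs (coeff α g))
        have h5 := hX (expVec i (symM a b c) 0 (α 3 + symL a b c)) (coeff α g) hm
        simpa using add_mem h4 h5
      · refine Ideal.mem_sup_left (monomial_mem_symDefIdeal K h ?_ _)
        have hs : SameExp a b c i (symM a b c) k (α 3 + symL a b c) (α 0) (α 1) (α 2) (α 3) := by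
          rw [hi, hk, h3]
          have := (sameExp_binomial h i (α 3)).symm
          obtain ⟨h1, h2, h3⟩ := this
          exact ⟨by omega, by linarith, by linarith⟩
        exact (isZeroExp_of_pos h hm hk0).congr h hs
  obtain ⟨p, hp, q, hq, rfl⟩ := Submodule.mem_sup.mp hmem
  obtain ⟨q, rfl⟩ := Ideal.mem_span_singleton.mp hq
  exact ⟨q, by simpa using hp⟩

/-- With `P` the polynomial ring, this uses the exact sequence `0 → P/(J : z₂) → P/J → P/(J + (z₂))
→ 0`: an element regular on both ends is regular in the middle. -/
theorem mem_symDefIdeal_of_mul_mem {t : MvPolynomial (Fin 4) K}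
    (hsum : ∀ g : MvPolynomial (Fin 4) K, (∀ α ∈ (t * g).support, α ∈ sumSet a b c) →
      ∀ α ∈ g.support, α ∈ sumSet a b c)
    (hcol : ∀ g : MvPolynomial (Fin 4) K, (∀ α ∈ (t * g).support, α ∈ colonSet a b c) →
      ∀ α ∈ g.support, α ∈ colonSet a b c)
    {g : MvPolynomial (Fin 4) K} (hg : t * g ∈ symDefIdeal K a b c) : g ∈ symDefIdeal K a b c := by
  obtain ⟨q, hq⟩ := exists_sub_X_one_mul_mem h (hsum g (support_subset_sumSet h hg))
  have h1 : X 1 * (t * q) ∈ symDefIdeal K a b c := by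
    have := sub_mem hg (Ideal.mul_mem_left _ t hq)
    convert this using 1
    ring
  have h2 := (X_one_mul_mem_iff h).mpr (hcol q ((X_one_mul_mem_iff h).mp h1))
  simpa using add_mem hq h2

theorem mem_symDefIdeal_of_X_add_X_mul_mem {g : MvPolynomial (Fin 4) K}
    (hg : (X 0 + X 3) * g ∈ symDefIdeal K a b c) : g ∈ symDefIdeal K a b c := by
  refine mem_symDefIdeal_of_mul_mem h (fun g hg => ?_) (fun g hg => ?_) hg
  -- The leading variable is `z₄` modulo `J + (z₂)` and `z₁` modulo `J : z₂`; this is why the sum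
  -- `z₁ + z₄` is used.
  · refine mem_of_X_add_mul_mem (i := 3) (j := 0) (by decide) 1 (isUpperSet_sumSet a b c)
      (sumSet_cancel_three h) ?_
    rwa [C_1, one_mul, add_comm]
  · refine mem_of_X_add_mul_mem (i := 0) (j := 3) (by decide) 1 (isUpperSet_colonSet a b c)
      (colonSet_cancel_zero h) ?_
    rwa [C_1, one_mul]

theorem mem_symDefIdeal_of_X_three_mul_mem (hP : NoMixed a b c) {g : MvPolynomial (Fin 4) K}
    (hg : X 3 * g ∈ symDefIdeal K a b c) : g ∈ symDefIdeal K a b c := by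
  refine mem_symDefIdeal_of_mul_mem h (fun g hg => ?_) (fun g hg => ?_) hg
  · refine mem_of_X_add_mul_mem (i := 3) (j := 0) (by decide) 0 (isUpperSet_sumSet a b c)
      (sumSet_cancel_three h) ?_
    rwa [C_0, zero_mul, add_zero]
  · refine mem_of_X_add_mul_mem (i := 3) (j := 0) (by decide) 0 (isUpperSet_colonSet a b c)
      (colonSet_cancel_three h hP) ?_
    rwa [C_0, zero_mul, add_zero]

/-- The ideal generated by `z₂` in `F(I)` is a copy of the quotient by `J : z₂`, on which `z₁` is
always a nonzerodivisor. -/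
theorem X_one_mul_mem_of_X_zero_mul_mem {g : MvPolynomial (Fin 4) K}
    (hg : X 0 * (X 1 * g) ∈ symDefIdeal K a b c) : X 1 * g ∈ symDefIdeal K a b c := by
  rw [mul_left_comm, X_one_mul_mem_iff h] at hg
  rw [X_one_mul_mem_iff h]
  refine mem_of_X_add_mul_mem (i := 0) (j := 3) (by decide) 0 (isUpperSet_colonSet a b c)
    (colonSet_cancel_zero h) ?_
  rwa [C_0, zero_mul, add_zero]

end

/-! ### Regular sequences, depth and Krull dimension. -/

section Depth

open RingTheory.Sequence
open scoped Pointwise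

variable {R : Type*} [CommRing R]

theorem isSMulRegular_quotSMulTop_iff (t s : R) :
    IsSMulRegular (QuotSMulTop t R) s ↔ ∀ x, t ∣ s * x → t ∣ x := by
  have hmem : ∀ x : R, x ∈ t • (⊤ : Submodule R R) ↔ t ∣ x := by
    intro x
    rw [Submodule.mem_smul_pointwise_iff_exists]
    simp [dvd_def, eq_comm]
  refine (isSMulRegular_quotient_iff_mem_of_smul_mem _ _).trans ?_
  simp only [hmem, smul_eq_mul]

theorem isWeaklyRegular_pair_iff (t s : R) :
    IsWeaklyRegular R [t, s] ↔ (∀ x, t * x = 0 → x = 0) ∧ ∀ x, t ∣ s * x → t ∣ x := by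
  rw [isWeaklyRegular_cons_iff, isWeaklyRegular_singleton_iff, isSMulRegular_quotSMulTop_iff,
    isSMulRegular_iff_right_eq_zero_of_smul]
  simp only [smul_eq_mul]

theorem isRegular_of_mem {𝔫 : Ideal R} (h𝔫 : 𝔫 ≠ ⊤) {rs : List R} (hrs : ∀ r ∈ rs, r ∈ 𝔫)
    (h : IsWeaklyRegular R rs) : IsRegular R rs := by
  refine ⟨h, fun H => h𝔫 ?_⟩
  have hle : Ideal.ofList rs ≤ 𝔫 := Ideal.span_le.mpr hrs
  rw [eq_top_iff, H, smul_eq_mul, Ideal.mul_top]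
  exact hle

theorem one_le_depthAlong {𝔫 : Ideal R} (h𝔫 : 𝔫 ≠ ⊤) {t : R} (ht : t ∈ 𝔫)
    (h : ∀ x, t * x = 0 → x = 0) : 1 ≤ depthAlong 𝔫 := by
  have hmem : ∀ r ∈ [t], r ∈ 𝔫 := by simpa using ht
  refine le_iSup₂_of_le [t] ⟨hmem, isRegular_of_mem h𝔫 hmem ?_⟩ (by simp)
  rw [isWeaklyRegular_singleton_iff, isSMulRegular_iff_right_eq_zero_of_smul]
  exact h

theorem two_le_depthAlong {𝔫 : Ideal R} (h𝔫 : 𝔫 ≠ ⊤) {t s : R} (ht : t ∈ 𝔫) (hs : s ∈ 𝔫)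
    (h : ∀ x, t * x = 0 → x = 0) (h' : ∀ x, t ∣ s * x → t ∣ x) : 2 ≤ depthAlong 𝔫 := by
  have hmem : ∀ r ∈ [t, s], r ∈ 𝔫 := by simp [ht, hs]
  refine le_iSup₂_of_le [t, s] ⟨hmem, isRegular_of_mem h𝔫 hmem ?_⟩ (by simp)
  exact (isWeaklyRegular_pair_iff t s).mpr ⟨h, h'⟩

theorem depthAlong_le_one {𝔫 : Ideal R}
    (H : ∀ t ∈ 𝔫, ∀ s ∈ 𝔫, (∀ x, t * x = 0 → x = 0) → (∀ x, t ∣ s * x → t ∣ x) → False) :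
    depthAlong 𝔫 ≤ 1 := by
  refine iSup₂_le fun rs hrs => ?_
  obtain ⟨hmem, hreg⟩ := hrs
  rcases rs with _ | ⟨t, _ | ⟨s, rs⟩⟩
  · simp
  · simp
  · exfalso
    have := hreg.toIsWeaklyRegular
    rw [isWeaklyRegular_cons_iff, isWeaklyRegular_cons_iff, isSMulRegular_quotSMulTop_iff,
      isSMulRegular_iff_right_eq_zero_of_smul] at this
    exact H t (hmem t (by simp)) s (hmem s (by simp)) this.1 this.2.1

/-- Dividing by a nonzerodivisor lowers the dimension by at least one, and properness of the ideal
keeps the last quotient nonzero. -/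
theorem IsWeaklyRegular.length_le_ringKrullDim {R : Type*} [CommRing R] {rs : List R}
    (h : IsWeaklyRegular R rs) (hne : Ideal.ofList rs ≠ ⊤) :
    (rs.length : WithBot ℕ∞) ≤ ringKrullDim R := by
  obtain ⟨n, hn⟩ : ∃ n, rs.length = n := ⟨_, rfl⟩
  induction n generalizing R with
  | zero =>
    have : Nontrivial R := by
      by_contra H
      rw [not_nontrivial_iff_subsingleton] at H
      exact hne (Subsingleton.elim _ _)
    rw [hn]
    exact ringKrullDim_nonneg_of_nontrivial
  | succ n ih =>
    rcases rs with _ | ⟨r, rs⟩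
    · simp at hn
    rw [isWeaklyRegular_cons_iff] at h
    obtain ⟨h1, h2⟩ := h
    let π := algebraMap R (R ⧸ Ideal.span {r})
    have hπ : Function.Surjective π := Ideal.Quotient.mk_surjective
    have heq : r • (⊤ : Submodule R R) = Ideal.span {r} := by
      ext x
      rw [Submodule.mem_smul_pointwise_iff_exists, Ideal.mem_span_singleton]
      simp [dvd_def, eq_comm]
    have h3 : IsWeaklyRegular (R ⧸ Ideal.span {r}) (rs.map π) := by
      rw [isWeaklyRegular_map_algebraMap_iff]
      exact ((Submodule.quotEquivOfEq _ _ heq).isWeaklyRegular_congr rs).mp h2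
    have h4 : Ideal.ofList (rs.map π) ≠ ⊤ := by
      rw [← Ideal.map_ofList]
      intro H
      apply hne
      have := congrArg (Ideal.comap π) H
      rw [Ideal.comap_map_of_surjective π hπ, Ideal.comap_top] at this
      rw [Ideal.ofList_cons, sup_comm, ← this]
      congr 1
      exact (Ideal.mk_ker (I := Ideal.span {r})).symm
    have h5 := ih h3 h4 (by simpa using hn)
    have h6 := ringKrullDim_quotient_succ_le_of_nonZeroDivisor (r := r) (by
      rw [mem_nonZeroDivisors_iff_right]
      intro x hx
      exact (isSMulRegular_iff_right_eq_zero_of_smul.mp h1) x (by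
        rwa [smul_eq_mul, mul_comm]))
    refine le_trans ?_ h6
    rw [List.length_map] at h5
    rw [List.length_cons]
    push_cast
    gcongr

theorem depthAlong_le_ringKrullDim {𝔫 : Ideal R} (h𝔫 : 𝔫 ≠ ⊤) :
    (depthAlong 𝔫 : WithBot ℕ∞) ≤ ringKrullDim R := by
  have : Nontrivial R := by
    by_contra H
    rw [not_nontrivial_iff_subsingleton] at H
    exact h𝔫 (Subsingleton.elim _ _)
  obtain ⟨d, hd⟩ := WithBot.ne_bot_iff_exists.mp (fun H : ringKrullDim R = ⊥ => by
    have := ringKrullDim_nonneg_of_nontrivial (R := R)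
    simp [H] at this)
  rw [← hd, WithBot.coe_le_coe]
  refine iSup₂_le fun rs hrs => ?_
  rw [← WithBot.coe_le_coe, hd]
  refine IsWeaklyRegular.length_le_ringKrullDim hrs.2.toIsWeaklyRegular fun H => ?_
  exact h𝔫 (eq_top_iff.mpr (H ▸ Ideal.span_le.mpr hrs.1))

theorem dvd_of_dvd_pow_mul {t s : R} (ht : ∀ x, t * x = 0 → x = 0)
    (hs : ∀ x, t ∣ s * x → t ∣ x) (m n : ℕ) : ∀ x, t ^ m ∣ s ^ n * x → t ^ m ∣ x := by
  have hs' : ∀ n x, t ∣ s ^ n * x → t ∣ x := by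
    intro n
    induction n with
    | zero => simp
    | succ n ih =>
      intro x hx
      rw [pow_succ, mul_assoc] at hx
      exact hs x (ih _ hx)
  induction m with
  | zero => simp
  | succ m ih =>
    intro x hx
    obtain ⟨y, rfl⟩ := hs' n x ((dvd_pow_self t m.succ_ne_zero).trans hx)
    rw [pow_succ']
    refine mul_dvd_mul_left t (ih y ?_)
    obtain ⟨w, hw⟩ := hx
    refine ⟨w, sub_eq_zero.mp (ht _ ?_)⟩
    linear_combination hw

/-- If `v` is not divisible by `z`, but some power of the ideal `𝔫` maps `v` into `z L`, where `z`
is a nonzerodivisor on the ideal `L`, then there is no regular sequence of length two in `𝔫`. -/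
theorem depthAlong_le_one_of_radical {𝔫 L : Ideal R} {v z : R}
    (hz : ∀ x ∈ L, z * x = 0 → x = 0) (hv : ¬ z ∣ v)
    (h𝔫 : ∀ t ∈ 𝔫, ∃ n, ∃ p ∈ L, t ^ n * v = z * p) : depthAlong 𝔫 ≤ 1 := by
  refine depthAlong_le_one fun t ht s hs h1 h2 => hv ?_
  obtain ⟨m, p, hp, hp'⟩ := h𝔫 t ht
  -- Both `s ^ n * p` and `t ^ m * q` become `t ^ m * s ^ n * v` after multiplication by `z`, so
  -- they agree. Regularity then gives `p = t ^ m * w`, and cancelling `t ^ m` makes `v` equal to `z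
  -- * w`.
  obtain ⟨n, q, hq, hq'⟩ := h𝔫 s hs
  have h3 : s ^ n * p - t ^ m * q = 0 := by
    refine hz _ (sub_mem (L.mul_mem_left _ hp) (L.mul_mem_left _ hq)) ?_
    linear_combination t ^ m * hq' - s ^ n * hp'
  obtain ⟨w, rfl⟩ := dvd_of_dvd_pow_mul h1 h2 m n p ⟨q, sub_eq_zero.mp h3⟩
  have h4 : ∀ k x, t ^ k * x = 0 → x = 0 := by
    intro k
    induction k with
    | zero => simp
    | succ k ih =>
      intro x hx
      rw [pow_succ, mul_assoc] at hx
      exact h1 x (ih _ hx)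
  refine ⟨w, sub_eq_zero.mp (h4 m _ ?_)⟩
  linear_combination hp'

end Depth

/-! ### The presentation `K[z₁, …, z₄] → F(I)`, the irrelevant ideal and the dimension. -/

section Presentation

variable (K : Type*) [Field K] (a b c : ℕ)

theorem constantCoeff_eq_zero_of_mem_maxIdealXY {g : MvPolynomial (Fin 2) K}
    (hg : g ∈ maxIdealXY K) : constantCoeff g = 0 := by
  have : maxIdealXY K ≤ RingHom.ker (constantCoeff (R := K) (σ := Fin 2)) := by
    rw [maxIdealXY, Ideal.span_le]
    rintro _ (rfl | rfl) <;> simp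
  exact this hg

theorem sub_C_constantCoeff_mem (g : MvPolynomial (Fin 2) K) :
    g - C (constantCoeff g) ∈ maxIdealXY K := by
  induction g using MvPolynomial.induction_on with
  | C r => simp
  | add p q hp hq =>
    have := add_mem hp hq
    convert this using 1
    simp only [map_add]
    ring
  | mul_X p i hp =>
    simp only [map_mul, constantCoeff_X, mul_zero, map_zero, sub_zero]
    refine Ideal.mul_mem_left _ _ (Ideal.subset_span ?_)
    fin_cases i <;> simp

theorem mk_algebraMap_eq (g : MvPolynomial (Fin 2) K) :
    (Ideal.Quotient.mk _ (algebraMap _ (reesAlgebra (symIdeal K a b c)) g) : SymFiberCone K a b c) =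
      algebraMap K (SymFiberCone K a b c) (constantCoeff g) := by
  have h1 : algebraMap K (SymFiberCone K a b c) (constantCoeff g) = Ideal.Quotient.mk _
      (algebraMap (MvPolynomial (Fin 2) K) (reesAlgebra (symIdeal K a b c))
        (C (constantCoeff g))) := rfl
  rw [h1, Ideal.Quotient.eq, ← map_sub]
  exact Ideal.mem_map_of_mem _ (sub_C_constantCoeff_mem K g)

/-- The Rees algebra is generated in degree one over `K[x, y]`, and modulo `𝔪` a coefficient from
`K[x, y]` reduces to its constant term. -/
theorem symFiberMap_surjective : Function.Surjective (symFiberMap K a b c) := by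
  intro w
  obtain ⟨⟨f, hf⟩, rfl⟩ := Ideal.Quotient.mk_surjective w
  have hf' := hf
  rw [← adjoin_monomial_eq_reesAlgebra] at hf'
  change Ideal.Quotient.mk _ _ ∈ (symFiberMap K a b c).range
  have key : ∀ f ∈ Algebra.adjoin (MvPolynomial (Fin 2) K) (Submodule.map (Polynomial.monomial 1 :
      MvPolynomial (Fin 2) K →ₗ[MvPolynomial (Fin 2) K] _) (symIdeal K a b c) : Set _),
      ∃ x : reesAlgebra (symIdeal K a b c), (x : Polynomial (MvPolynomial (Fin 2) K)) = f ∧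
        (Ideal.Quotient.mk _ x : SymFiberCone K a b c) ∈ (symFiberMap K a b c).range := by
    intro f hf
    induction hf using Algebra.adjoin_induction with
    | mem f hf =>
      obtain ⟨u, hu, rfl⟩ := hf
      induction hu using Submodule.span_induction with
      | mem u hu =>
        obtain ⟨i, rfl⟩ := hu
        refine ⟨toRees K a b c (X i), ?_, ?_⟩
        · rw [toRees, aeval_X]
        · rw [← symFiberMap_eq]
          exact ⟨_, rfl⟩
      | zero => exact ⟨0, by simp, by simp⟩
      | add u v _ _ hu hv =>
        obtain ⟨x, hx, hx'⟩ := hu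
        obtain ⟨y, hy, hy'⟩ := hv
        refine ⟨x + y, ?_, ?_⟩
        · rw [Subalgebra.coe_add, hx, hy, map_add]
        · rw [map_add]
          exact add_mem hx' hy'
      | smul g u _ hu =>
        obtain ⟨x, hx, hx'⟩ := hu
        refine ⟨algebraMap _ _ g * x, ?_, ?_⟩
        · rw [map_smul, ← hx]
          exact (Algebra.smul_def g (x : Polynomial (MvPolynomial (Fin 2) K))).symm
        · rw [map_mul, mk_algebraMap_eq]
          exact mul_mem (Subalgebra.algebraMap_mem _ _) hx'
    | algebraMap g =>
      refine ⟨algebraMap _ _ g, rfl, ?_⟩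
      rw [mk_algebraMap_eq]
      exact Subalgebra.algebraMap_mem _ _
    | add u v _ _ hu hv =>
      obtain ⟨x, hx, hx'⟩ := hu
      obtain ⟨y, hy, hy'⟩ := hv
      refine ⟨x + y, ?_, ?_⟩
      · rw [Subalgebra.coe_add, hx, hy]
      · rw [map_add]
        exact add_mem hx' hy'
    | mul u v _ _ hu hv =>
      obtain ⟨x, hx, hx'⟩ := hu
      obtain ⟨y, hy, hy'⟩ := hv
      refine ⟨x * y, ?_, ?_⟩
      · rw [MulMemClass.coe_mul, hx, hy]
      · rw [map_mul]
        exact mul_mem hx' hy'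
  obtain ⟨x, hx, hx'⟩ := key f hf'
  have : x = ⟨f, hf⟩ := Subtype.ext hx
  rwa [← this]

/-- The ideal `F(I)₊`. -/
noncomputable abbrev symIrrelevant : Ideal (SymFiberCone K a b c) :=
  fiberConeIrrelevant (maxIdealXY K) (symIdeal K a b c)

/-- The augmentation `F(I) → K`. -/
noncomputable def symAugmentation : SymFiberCone K a b c →+* K :=
  Ideal.Quotient.lift _ ((constantCoeff.comp Polynomial.constantCoeff).comp
    (reesAlgebra (symIdeal K a b c)).val.toRingHom) fun x hx => by
      rw [mem_map_algebraMap_reesAlgebra_iff] at hx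
      have := hx 0
      rw [pow_zero, mul_one] at this
      exact constantCoeff_eq_zero_of_mem_maxIdealXY K this

theorem symAugmentation_eq_zero {w : SymFiberCone K a b c} (hw : w ∈ symIrrelevant K a b c) :
    symAugmentation K a b c w = 0 := by
  have : symIrrelevant K a b c ≤ RingHom.ker (symAugmentation K a b c) := by
    rw [symIrrelevant, fiberConeIrrelevant, Ideal.map_le_iff_le_comap]
    intro x hx
    rw [RingHom.mem_ker, RingHom.comp_apply] at hx
    rw [Ideal.mem_comap, RingHom.mem_ker, symAugmentation, Ideal.Quotient.lift_mk,
      RingHom.comp_apply, RingHom.comp_apply]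
    exact (congrArg constantCoeff hx).trans (map_zero _)
  exact this hw

theorem symIrrelevant_ne_top : symIrrelevant K a b c ≠ ⊤ := by
  intro H
  have := symAugmentation_eq_zero K a b c (w := 1) (H ▸ Submodule.mem_top)
  simp at this

theorem symFiberMap_X_mem (i : Fin 4) : symFiberMap K a b c (X i) ∈ symIrrelevant K a b c := by
  rw [symFiberMap, aeval_X]
  refine Ideal.mem_map_of_mem _ ?_
  rw [RingHom.mem_ker]
  change (Polynomial.monomial 1 (symGen K a b c i)).coeff 0 = 0
  simp [Polynomial.coeff_monomial]

theorem symIrrelevant_le :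
    symIrrelevant K a b c ≤ Ideal.span (Set.range fun i => symFiberMap K a b c (X i)) := by
  intro w hw
  obtain ⟨p, rfl⟩ := symFiberMap_surjective K a b c w
  have h0 := symAugmentation_eq_zero K a b c hw
  have hX : ∀ q : MvPolynomial (Fin 4) K, symFiberMap K a b c q - symFiberMap K a b c
      (C (symAugmentation K a b c (symFiberMap K a b c q))) ∈
      Ideal.span (Set.range fun i => symFiberMap K a b c (X i)) := by
    intro q
    have haug : ∀ r : K, symAugmentation K a b c (symFiberMap K a b c (C r)) = r := by
      intro r
      rw [← algebraMap_eq, AlgHom.commutes]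
      change constantCoeff (Polynomial.constantCoeff (Polynomial.C (C r))) = r
      simp
    induction q using MvPolynomial.induction_on with
    | C r => rw [haug, sub_self]; exact zero_mem _
    | add p q hp hq =>
      have := add_mem hp hq
      convert this using 1
      simp only [map_add]
      ring
    | mul_X p i hp =>
      rw [map_mul, map_mul, symAugmentation_eq_zero K a b c (symFiberMap_X_mem K a b c i),
        mul_zero, C_0, map_zero, sub_zero]
      exact Ideal.mul_mem_left _ _ (Ideal.subset_span ⟨i, rfl⟩)
  have := hX p
  rwa [h0, C_0, map_zero, sub_zero] at this

variable {a b c} in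
-- `J` and the kernel `(z₂, z₃)` of the projection to a polynomial ring in two variables have the
-- same zero locus, because `z₂ᶜ` and `z₃ᶜ` lie in `J`.
theorem ringKrullDim_symFiberCone (h : IsUpTriple a b c) :
    ringKrullDim (SymFiberCone K a b c) = 2 := by
  let φ : MvPolynomial (Fin 4) K →ₐ[K] MvPolynomial (Fin 2) K := aeval ![X 0, 0, 0, X 1]
  let ι : MvPolynomial (Fin 2) K →ₐ[K] MvPolynomial (Fin 4) K := aeval ![X 0, X 3]
  have hφι : ∀ q, φ (ι q) = q := by
    intro q
    have : φ.comp ι = AlgHom.id K _ := by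
      ext i
      fin_cases i <;> simp [φ, ι]
    exact DFunLike.congr_fun this q
  have hJP : symDefIdeal K a b c ≤ RingHom.ker φ := by
    refine symDefIdeal_le K h (fun α hα => ?_) ?_
    · rw [← expVec_eta α, monomial_expVec, RingHom.mem_ker]
      have : α 1 ≠ 0 ∨ α 2 ≠ 0 := by
        by_contra! H
        rw [zeroSet, Set.mem_ofPred_eq, H.1, H.2] at hα
        exact not_isZeroExp_pure hα
      rcases this with H | H <;> simp [φ, H]
    · simp [RingHom.mem_ker, symBinomial, φ, (symM_pos h).ne']
  have hPJ : RingHom.ker φ ≤ (symDefIdeal K a b c).radical := by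
    have hpow : ∀ i : Fin 4, i = 1 ∨ i = 2 → X i ∈ (symDefIdeal K a b c).radical := by
      intro i hi
      refine ⟨c, ?_⟩
      rw [X_pow_eq_monomial]
      refine monomial_mem_symDefIdeal K h ?_ 1
      rcases hi with rfl | rfl
      · simpa [zeroSet, Finsupp.single_apply] using isZeroExp_pow h
      · simpa [zeroSet, Finsupp.single_apply] using (isZeroExp_pow h).symm
    have hsub : ∀ p, p - ι (φ p) ∈ (symDefIdeal K a b c).radical := by
      intro p
      rw [← Ideal.Quotient.eq]
      have : (Ideal.Quotient.mkₐ K (symDefIdeal K a b c).radical) =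
          ((Ideal.Quotient.mkₐ K (symDefIdeal K a b c).radical).comp ι).comp φ := by
        ext i
        fin_cases i
        · simp [φ, ι]
        · simpa [φ, ι] using Ideal.Quotient.eq_zero_iff_mem.mpr (hpow 1 (by simp))
        · simpa [φ, ι] using Ideal.Quotient.eq_zero_iff_mem.mpr (hpow 2 (by simp))
        · simp [φ, ι]
      exact DFunLike.congr_fun this p
    intro p hp
    have := hsub p
    rwa [RingHom.mem_ker.mp hp, map_zero, sub_zero] at this
  have hloc : PrimeSpectrum.zeroLocus (symDefIdeal K a b c : Set (MvPolynomial (Fin 4) K)) =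
      PrimeSpectrum.zeroLocus (RingHom.ker φ : Set (MvPolynomial (Fin 4) K)) := by
    refine subset_antisymm ?_ (PrimeSpectrum.zeroLocus_anti_mono hJP)
    rw [← PrimeSpectrum.zeroLocus_radical (symDefIdeal K a b c)]
    exact PrimeSpectrum.zeroLocus_anti_mono hPJ
  have e1 := ringKrullDim_eq_of_ringEquiv (R := MvPolynomial (Fin 4) K ⧸ RingHom.ker
    (symFiberMap K a b c : MvPolynomial (Fin 4) K →+* SymFiberCone K a b c))
    (S := SymFiberCone K a b c) (RingHom.quotientKerEquivOfSurjective
    (f := (symFiberMap K a b c : MvPolynomial (Fin 4) K →+* SymFiberCone K a b c))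
    (symFiberMap_surjective K a b c))
  have e2 := ringKrullDim_eq_of_ringEquiv (RingHom.quotientKerEquivOfSurjective
    (f := (φ : MvPolynomial (Fin 4) K →+* MvPolynomial (Fin 2) K)) fun q => ⟨ι q, hφι q⟩)
  rw [ringKrullDim_quotient] at e1 e2
  rw [← e1]
  have e3 : PrimeSpectrum.zeroLocus (RingHom.ker (symFiberMap K a b c :
      MvPolynomial (Fin 4) K →+* SymFiberCone K a b c) : Set (MvPolynomial (Fin 4) K)) =
      PrimeSpectrum.zeroLocus (RingHom.ker (φ : MvPolynomial (Fin 4) K →+* MvPolynomial (Fin 2) K) :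
        Set (MvPolynomial (Fin 4) K)) := hloc
  rw [e3, e2, MvPolynomial.ringKrullDim_of_isNoetherianRing, ringKrullDim_eq_zero_of_field]
  simp

end Presentation

/-- The elements `y` with `y v ∈ z L` form an ideal, so it suffices that its radical contains
generators of `𝔫`. -/
theorem depthAlong_le_one_of_generators {R ι : Type*} [CommRing R] {𝔫 L : Ideal R} {v z : R}
    (hz : ∀ x ∈ L, z * x = 0 → x = 0) (hv : ¬ z ∣ v) (x : ι → R)
    (h𝔫 : 𝔫 ≤ Ideal.span (Set.range x)) (hx : ∀ i, ∃ n, ∃ p ∈ L, x i ^ n * v = z * p) :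
    depthAlong 𝔫 ≤ 1 := by
  refine depthAlong_le_one_of_radical hz hv fun t ht => ?_
  let 𝔟 : Ideal R := Submodule.comap (LinearMap.toSpanSingleton R R v)
    (Submodule.map (LinearMap.mulLeft R z) L)
  have hb : ∀ y, y ∈ 𝔟 ↔ ∃ p ∈ L, y * v = z * p := by
    intro y
    simp [𝔟, eq_comm]
  have hle : Ideal.span (Set.range x) ≤ 𝔟.radical := by
    rw [Ideal.span_le]
    rintro _ ⟨i, rfl⟩
    obtain ⟨n, hn⟩ := hx i
    exact ⟨n, (hb _).mpr hn⟩
  obtain ⟨n, hn⟩ := hle (h𝔫 ht)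
  exact ⟨n, (hb _).mp hn⟩

/-! ### The depth of `F(I)`. -/

section

variable (K : Type*) [Field K] {a b c : ℕ}

theorem symFiberMap_eq_zero_iff {p : MvPolynomial (Fin 4) K} :
    symFiberMap K a b c p = 0 ↔ p ∈ symDefIdeal K a b c := RingHom.mem_ker.symm

theorem symFiberMap_eq_zero_of_eq (h : IsUpTriple a b c) {i j k l : ℕ}
    (hz : IsZeroExp a b c i j k l) {p : MvPolynomial (Fin 4) K}
    (hp : p = X 0 ^ i * X 1 ^ j * X 2 ^ k * X 3 ^ l) : symFiberMap K a b c p = 0 := by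
  rw [symFiberMap_eq_zero_iff, hp, ← monomial_expVec]
  exact monomial_mem_symDefIdeal K h hz 1

theorem one_le_symDepth (h : IsUpTriple a b c) : 1 ≤ symDepth K a b c := by
  refine one_le_depthAlong (symIrrelevant_ne_top K a b c) (t := symFiberMap K a b c (X 0 + X 3)) ?_
    ?_
  · rw [map_add]
    exact add_mem (symFiberMap_X_mem K a b c 0) (symFiberMap_X_mem K a b c 3)
  · intro x hx
    obtain ⟨g, rfl⟩ := symFiberMap_surjective K a b c x
    rw [← map_mul, symFiberMap_eq_zero_iff] at hx
    exact (symFiberMap_eq_zero_iff K).mpr (mem_symDefIdeal_of_X_add_X_mul_mem h hx)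

theorem symDepth_le_one_of_not_noMixed (h : IsUpTriple a b c) (hP : ¬ NoMixed a b c) :
    symDepth K a b c ≤ 1 := by
  simp only [NoMixed, not_forall] at hP
  obtain ⟨i, k, hz, hnz⟩ := hP
  have hk : 0 < k := by
    by_contra! H
    obtain rfl : k = 0 := by omega
    exact not_isZeroExp_pure hz
  have hℓ := symL_pos h
  -- Here `z₁ⁱz₃ᵏ` vanishes and `z₃ᵏ` does not, and likewise `z₂ᵏz₄ⁱ` and `z₂ᵏ`. As `z₁` need not be
  -- regular on `F(I)`, `L` is the ideal `(z₂)`, on which it is.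
  refine depthAlong_le_one_of_generators (L := Ideal.span {symFiberMap K a b c (X 1)})
    (v := symFiberMap K a b c (X 1 ^ k)) (z := symFiberMap K a b c (X 0)) ?_ ?_
    (fun i => symFiberMap K a b c (X i)) (symIrrelevant_le K a b c) ?_
  · intro x hx hx0
    obtain ⟨y, rfl⟩ := Ideal.mem_span_singleton.mp hx
    obtain ⟨g, rfl⟩ := symFiberMap_surjective K a b c y
    rw [← map_mul, ← map_mul, symFiberMap_eq_zero_iff] at hx0
    rw [← map_mul, symFiberMap_eq_zero_iff]
    exact X_one_mul_mem_of_X_zero_mul_mem h hx0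
  · rintro ⟨y, hy⟩
    obtain ⟨g, rfl⟩ := symFiberMap_surjective K a b c y
    rw [← map_mul, ← sub_eq_zero, ← map_sub, symFiberMap_eq_zero_iff] at hy
    have hv : (X 1 ^ k : MvPolynomial (Fin 4) K) = monomial (expVec 0 k 0 0) 1 := by
      simp [monomial_expVec]
    have := coeff_eq_zero_of_mem_symDefIdeal K h hy (α := expVec 0 k 0 0)
      (fun H => hnz (IsZeroExp.symm H)) ?_
    · rw [coeff_sub, hv, coeff_monomial, if_pos rfl, coeff_X_mul', if_neg (by simp)] at this
      simp at this
    · intro β _ hs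
      have hβ : β ∉ zeroSet a b c := fun H => hnz (IsZeroExp.symm (IsZeroExp.congr h H hs))
      rcases hs.eq_or_binomial h hβ with H | H | H
      · exact exp_ext_iff.mpr H
      · simp only [expVec_one] at H
        omega
      · simp only [expVec_three] at H
        omega
  · intro j
    have h0 : ∀ n, symFiberMap K a b c (X j ^ n * X 1 ^ k) = 0 →
        ∃ n, ∃ p ∈ Ideal.span {symFiberMap K a b c (X 1)},
        symFiberMap K a b c (X j) ^ n * symFiberMap K a b c (X 1 ^ k) =
          symFiberMap K a b c (X 0) * p := by
      intro n hn
      exact ⟨n, 0, zero_mem _, by rw [← map_pow, ← map_mul, hn, mul_zero]⟩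
    obtain rfl | rfl | rfl | rfl : j = 0 ∨ j = 1 ∨ j = 2 ∨ j = 3 := by fin_cases j <;> simp
    · refine ⟨1, symFiberMap K a b c (X 1 ^ k), ?_, by simp⟩
      rw [map_pow]
      exact Ideal.pow_mem_of_mem _ (Ideal.mem_span_singleton_self _) k hk
    · exact h0 c (symFiberMap_eq_zero_of_eq K h ((isZeroExp_pow h).mono (le_refl 0)
        (le_add_right (le_refl c) : c ≤ c + k) (le_refl 0) (le_refl 0)) (by ring))
    · exact h0 1 (symFiberMap_eq_zero_of_eq K h (isZeroExp_of_pos (i := 0) (l := 0) h hk one_pos)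
        (by ring))
    · exact h0 i (symFiberMap_eq_zero_of_eq K h hz.symm (by ring))

theorem symDepth_le_one_of_noMixed (h : IsUpTriple a b c) (hP : NoMixed a b c)
    (hf : ¬ IsZeroExp a b c (symL a b c) 0 (symM a b c) 0) : symDepth K a b c ≤ 1 := by
  have hℓ := symL_pos h
  have hm := symM_pos h
  have hz : ∀ n (g : MvPolynomial (Fin 4) K),
      X 3 ^ n * g ∈ symDefIdeal K a b c → g ∈ symDefIdeal K a b c := by
    intro n
    induction n with
    | zero => simp
    | succ n ih =>
      intro g hg
      rw [pow_succ, mul_assoc] at hg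
      exact mem_symDefIdeal_of_X_three_mul_mem h hP (ih _ hg)
  have hnz : ¬ IsZeroExp a b c 0 0 (symM a b c) 0 := fun H =>
    hf (H.mono (Nat.zero_le _) le_rfl le_rfl le_rfl)
  -- Without mixed monomials `z₄` is regular on all of `F(I)`. The fraction `z₃^m / z₄^ℓ` is moved
  -- into the ring by `z₁^ℓ` through the binomial, and killed by `z₂` and `z₃`.
  refine depthAlong_le_one_of_generators (L := ⊤)
    (v := symFiberMap K a b c (X 2 ^ symM a b c)) (z := symFiberMap K a b c (X 3 ^ symL a b c)) ?_ ?_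
    (fun i => symFiberMap K a b c (X i)) (symIrrelevant_le K a b c) ?_
  · intro x _ hx0
    obtain ⟨g, rfl⟩ := symFiberMap_surjective K a b c x
    rw [← map_mul, symFiberMap_eq_zero_iff] at hx0
    exact (symFiberMap_eq_zero_iff K).mpr (hz _ _ hx0)
  · rintro ⟨y, hy⟩
    obtain ⟨g, rfl⟩ := symFiberMap_surjective K a b c y
    rw [← map_mul, ← sub_eq_zero, ← map_sub, symFiberMap_eq_zero_iff] at hy
    have hv : (X 2 ^ symM a b c : MvPolynomial (Fin 4) K) =
        monomial (expVec 0 0 (symM a b c) 0) 1 := by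
      simp [monomial_expVec]
    have := coeff_eq_zero_of_mem_symDefIdeal K h hy (α := expVec 0 0 (symM a b c) 0) hnz ?_
    · obtain ⟨l, hl⟩ := Nat.exists_eq_add_of_lt hℓ
      rw [hl, coeff_sub, hv, coeff_monomial, if_pos rfl, pow_succ', mul_assoc, coeff_X_mul',
        if_neg (by simp)] at this
      simp at this
    · intro β _ hs
      have hβ : β ∉ zeroSet a b c := fun H => hnz (IsZeroExp.congr h H hs)
      rcases hs.eq_or_binomial h hβ with H | H | H
      · exact exp_ext_iff.mpr H
      · simp only [expVec_zero] at H
        omega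
      · simp only [expVec_two] at H
        omega
  · intro j
    obtain rfl | rfl | rfl | rfl : j = 0 ∨ j = 1 ∨ j = 2 ∨ j = 3 := by fin_cases j <;> simp
    · refine ⟨symL a b c, symFiberMap K a b c (X 1 ^ symM a b c), trivial, ?_⟩
      have := (symFiberMap_eq_zero_iff K).mpr (symBinomial_mem K h)
      rw [symBinomial, map_sub, sub_eq_zero] at this
      rw [← map_pow, ← map_mul, this, mul_comm, map_mul]
    · refine ⟨1, 0, trivial, ?_⟩
      rw [← map_pow, ← map_mul, mul_zero]
      exact symFiberMap_eq_zero_of_eq K h (isZeroExp_of_pos (i := 0) (l := 0) h one_pos hm) (by ring)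
    · refine ⟨1, 0, trivial, ?_⟩
      rw [← map_pow, ← map_mul, mul_zero]
      -- The vanishing of `z₁^(ℓ-1) z₃^(m+1)` forces that of `z₃^(m+1)`.
      exact symFiberMap_eq_zero_of_eq K h (hP _ _ (isZeroExp_pred_symL h)) (by ring)
    · exact ⟨symL a b c, symFiberMap K a b c (X 2 ^ symM a b c), trivial, by simp⟩

theorem baseMonomials_eq (r : ℕ) : baseMonomials K r = (fun s => monomial s (1 : K)) ''
    {expVec 0 1 1 0, expVec 0 r 0 0, expVec 0 0 r 0} := by
  simp [baseMonomials, Set.image_insert_eq, monomial_expVec]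

theorem mem_span_of_X_mul_mem {T : Set (Fin 4 →₀ ℕ)} {i : Fin 4} (hT : ∀ γ ∈ T, γ i = 0)
    {g : MvPolynomial (Fin 4) K} (hg : X i * g ∈ Ideal.span ((fun s => monomial s (1 : K)) '' T)) :
    g ∈ Ideal.span ((fun s => monomial s (1 : K)) '' T) := by
  rw [mem_ideal_span_monomial_image] at hg ⊢
  obtain ⟨j, hij⟩ : ∃ j, i ≠ j := ⟨i + 1, by simp⟩
  refine mem_of_X_add_mul_mem (S := {α | ∃ γ ∈ T, γ ≤ α}) hij 0 ?_ ?_ (by simpa using hg)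
  · rintro α β hle ⟨γ, hγ, hγα⟩
    exact ⟨γ, hγ, hγα.trans hle⟩
  · rintro α ⟨γ, hγ, hγα⟩
    refine ⟨γ, hγ, fun k => ?_⟩
    have := hγα k
    by_cases hk : k = i
    · rw [hk, hT γ hγ]
      exact Nat.zero_le _
    · simpa [Finsupp.single_apply, Ne.symm hk] using this

theorem symDepth_eq_two (h : IsUpTriple a b c) (hI : CaseI K a b c) : symDepth K a b c = 2 := by
  obtain ⟨r, hJ, -⟩ := hI
  apply le_antisymm
  · rw [← WithBot.coe_le_coe]
    refine (depthAlong_le_ringKrullDim (symIrrelevant_ne_top K a b c)).trans ?_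
    rw [ringKrullDim_symFiberCone K h]
    rfl
  rw [baseMonomials_eq] at hJ
  set T : Set (Fin 4 →₀ ℕ) := {expVec 0 1 1 0, expVec 0 r 0 0, expVec 0 0 r 0} with hT
  refine two_le_depthAlong (symIrrelevant_ne_top K a b c) (symFiberMap_X_mem K a b c 0)
    (symFiberMap_X_mem K a b c 3) (fun x hx => ?_) fun x hx => ?_
  · obtain ⟨g, rfl⟩ := symFiberMap_surjective K a b c x
    rw [← map_mul, symFiberMap_eq_zero_iff, ← hJ] at hx
    rw [symFiberMap_eq_zero_iff, ← hJ]
    exact mem_span_of_X_mul_mem K (by simp [T]) hx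
  · obtain ⟨g, rfl⟩ := symFiberMap_surjective K a b c x
    -- Adjoining `z₁` to `J` keeps a monomial ideal whose generators do not involve `z₄`.
    have hdvd : ∀ p : MvPolynomial (Fin 4) K, symFiberMap K a b c (X 0) ∣ symFiberMap K a b c p ↔
        p ∈ Ideal.span ((fun s => monomial s (1 : K)) '' (insert (expVec 1 0 0 0) T)) := by
      intro p
      rw [Set.image_insert_eq, Ideal.span_insert, hJ, Submodule.mem_sup]
      have hX : (monomial (expVec 1 0 0 0) 1 : MvPolynomial (Fin 4) K) = X 0 := by
        simp [monomial_expVec]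
      rw [hX]
      constructor
      · rintro ⟨y, hy⟩
        obtain ⟨q, rfl⟩ := symFiberMap_surjective K a b c y
        rw [← map_mul, ← sub_eq_zero, ← map_sub, symFiberMap_eq_zero_iff] at hy
        exact ⟨X 0 * q, Ideal.mem_span_singleton.mpr ⟨q, rfl⟩, _, hy, by ring⟩
      · rintro ⟨y, hy, w, hw, rfl⟩
        obtain ⟨q, rfl⟩ := Ideal.mem_span_singleton.mp hy
        rw [map_add, (symFiberMap_eq_zero_iff K).mpr hw, add_zero, map_mul]
        exact ⟨_, rfl⟩
    rw [← map_mul, hdvd] at hx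
    rw [hdvd]
    exact mem_span_of_X_mul_mem K (by simp [T]) hx

end

/-! ### Minimal generators of `J`. -/

theorem notMem_span_diff_singleton {K σ : Type*} [Field K] {G : Set (MvPolynomial σ K)}
    {g : MvPolynomial σ K} {γ : σ →₀ ℕ} (hγ : coeff γ g ≠ 0)
    (hG : ∀ g' ∈ G, g' ≠ g → ∀ α ∈ g'.support, ¬ α ≤ γ) : g ∉ Ideal.span (G \ {g}) := by
  intro H
  have hle : Ideal.span (G \ {g}) ≤
      Ideal.span ((fun s => monomial s (1 : K)) '' {α | ¬ α ≤ γ}) := by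
    rw [Ideal.span_le]
    intro g' hg'
    exact mem_ideal_span_monomial_image.mpr fun α hα => ⟨α, hG g' hg'.1 hg'.2 α hα, le_rfl⟩
  obtain ⟨s, hs, hs'⟩ := mem_ideal_span_monomial_image.mp (hle H) γ (mem_support_iff.mpr hγ)
  exact hs hs'

/-- The exponents of the minimal monomials which vanish in the fiber cone. -/
def minZeroSet (a b c : ℕ) : Set (Fin 4 →₀ ℕ) := {α | Minimal (· ∈ zeroSet a b c) α}

/-- The pairs `(i, j)` of positive integers such that `z₁ⁱz₃ʲ` is a minimal monomial which vanishes
in the fiber cone. -/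
def mixedSet (a b c : ℕ) : Set (ℕ × ℕ) :=
  {q | 0 < q.1 ∧ 0 < q.2 ∧ expVec q.1 0 q.2 0 ∈ minZeroSet a b c}

/-- Dickson's lemma: an antichain of exponent vectors is finite. -/
theorem finite_minZeroSet (a b c : ℕ) : (minZeroSet a b c).Finite :=
  (setOfPred_minimal_antichain _).finite_of_partiallyWellOrderedOn
    (Set.isPWO_of_wellQuasiOrderedLE _)

theorem finite_mixedSet (a b c : ℕ) : (mixedSet a b c).Finite := by
  refine Set.Finite.of_injOn (f := fun q : ℕ × ℕ => expVec q.1 0 q.2 0) (fun q hq => hq.2.2) ?_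
    (finite_minZeroSet a b c)
  intro q _ q' _ hqq'
  have := exp_ext_iff.mp hqq'
  exact Prod.ext this.1 this.2.2.1

theorem exists_le_minZeroSet {a b c : ℕ} {α : Fin 4 →₀ ℕ} (hα : α ∈ zeroSet a b c) :
    ∃ β ∈ minZeroSet a b c, β ≤ α := by
  obtain ⟨β, h1, h2⟩ := exists_minimal_le_of_wellFoundedLT (· ∈ zeroSet a b c) α hα
  exact ⟨β, h2, h1⟩

theorem swap_mem_minZeroSet {a b c i j k l : ℕ} (h : expVec i j k l ∈ minZeroSet a b c) :
    expVec l k j i ∈ minZeroSet a b c := by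
  refine ⟨IsZeroExp.symm h.1, fun β hβ hle => ?_⟩
  have hle' : expVec (β 3) (β 2) (β 1) (β 0) ≤ expVec i j k l := by
    rw [exp_le_iff] at hle ⊢
    simp at hle ⊢
    omega
  have := h.2 (y := expVec (β 3) (β 2) (β 1) (β 0)) (IsZeroExp.symm hβ) hle'
  rw [exp_le_iff] at this ⊢
  simp at this ⊢
  omega

section

variable {a b c : ℕ}

theorem exists_isZeroExp_pow (h : IsUpTriple a b c) : ∃ j, IsZeroExp a b c 0 j 0 0 :=
  ⟨c, isZeroExp_pow h⟩

open Classical in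
/-- The smallest `r` such that `z₂ʳ` vanishes in the fiber cone. -/
noncomputable def powExp (h : IsUpTriple a b c) : ℕ := Nat.find (exists_isZeroExp_pow h)

open Classical in
theorem powExp_spec (h : IsUpTriple a b c) : IsZeroExp a b c 0 (powExp h) 0 0 :=
  Nat.find_spec (exists_isZeroExp_pow h)

open Classical in
theorem powExp_le (h : IsUpTriple a b c) {j : ℕ} (hj : IsZeroExp a b c 0 j 0 0) : powExp h ≤ j :=
  Nat.find_min' (exists_isZeroExp_pow h) hj

theorem powExp_pos (h : IsUpTriple a b c) : 0 < powExp h := by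
  by_contra! H
  have := powExp_spec h
  rw [Nat.le_zero.mp H] at this
  exact not_isZeroExp_pure this

theorem mul_mem_minZeroSet (h : IsUpTriple a b c) : expVec 0 1 1 0 ∈ minZeroSet a b c := by
  refine ⟨isZeroExp_of_pos h one_pos one_pos, fun β hβ hle => ?_⟩
  rw [exp_le_iff] at hle ⊢
  simp at hle ⊢
  rw [zeroSet, Set.mem_ofPred_eq, hle.1, hle.2.2.2] at hβ
  constructor
  · by_contra H
    obtain h1 : β 1 = 0 := by omega
    rw [h1] at hβ
    rcases Nat.le_one_iff_eq_zero_or_eq_one.mp hle.2.2.1 with h2 | h2 <;> rw [h2] at hβ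
    · exact not_isZeroExp_pure hβ
    · exact not_isZeroExp_one h hβ.symm
  · by_contra H
    obtain h1 : β 2 = 0 := by omega
    rw [h1] at hβ
    rcases Nat.le_one_iff_eq_zero_or_eq_one.mp hle.2.1 with h2 | h2 <;> rw [h2] at hβ
    · exact not_isZeroExp_pure hβ
    · exact not_isZeroExp_one h hβ

theorem pow_mem_minZeroSet (h : IsUpTriple a b c) : expVec 0 (powExp h) 0 0 ∈ minZeroSet a b c := by
  refine ⟨powExp_spec h, fun β hβ hle => ?_⟩
  rw [exp_le_iff] at hle ⊢
  simp at hle ⊢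
  rw [zeroSet, Set.mem_ofPred_eq, hle.1, hle.2.2.2, hle.2.2.1] at hβ
  exact powExp_le h hβ

theorem eq_of_mem_minZeroSet {α β : Fin 4 →₀ ℕ} (hα : α ∈ minZeroSet a b c)
    (hβ : β ∈ zeroSet a b c) (hle : β ≤ α) : β = α := le_antisymm hle (hα.2 hβ hle)

/-- Apart from `z₂z₃`, a minimal monomial contains exactly one of `z₂`, `z₃`; cancellation removes
`z₁` in the first case and `z₄` in the second. -/
theorem minZeroSet_cases (h : IsUpTriple a b c) {α : Fin 4 →₀ ℕ} (hα : α ∈ minZeroSet a b c) :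
    α = expVec 0 1 1 0 ∨ α = expVec 0 (powExp h) 0 0 ∨ α = expVec 0 0 (powExp h) 0 ∨
    ∃ q ∈ mixedSet a b c, α = expVec q.1 0 q.2 0 ∨ α = expVec 0 q.2 0 q.1 := by
  have aux : ∀ {i j l : ℕ}, 0 < j → expVec i j 0 l ∈ minZeroSet a b c → i = 0 ∧
      ((j = powExp h ∧ l = 0) ∨ (l, j) ∈ mixedSet a b c) := by
    intro i j l hj hmin
    have h1 : IsZeroExp a b c 0 j 0 l := IsZeroExp.cancel_le h hj hmin.1
    have h2 := eq_of_mem_minZeroSet hmin (β := expVec 0 j 0 l) h1 (by simp [exp_le_iff])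
    obtain rfl : i = 0 := by simpa using (exp_ext_iff.mp h2).1.symm
    refine ⟨rfl, ?_⟩
    rcases Nat.eq_zero_or_pos l with rfl | hl
    · left
      have h3 := eq_of_mem_minZeroSet hmin (β := expVec 0 (powExp h) 0 0) (powExp_spec h)
        (by simpa [exp_le_iff] using powExp_le h h1)
      exact ⟨by simpa using (exp_ext_iff.mp h3).2.1.symm, rfl⟩
    · exact Or.inr ⟨hl, hj, swap_mem_minZeroSet hmin⟩
  have hα0 := hα.1
  rw [← expVec_eta α] at hα
  rcases Nat.eq_zero_or_pos (α 1) with h1 | h1 <;> rcases Nat.eq_zero_or_pos (α 2) with h2 | h2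
  · rw [zeroSet, Set.mem_ofPred_eq, h1, h2] at hα0
    exact absurd hα0 not_isZeroExp_pure
  · rw [h1] at hα
    obtain ⟨h3, h4 | h4⟩ := aux h2 (swap_mem_minZeroSet hα)
    · right; right; left
      rw [exp_ext_iff]
      simp
      omega
    · right; right; right
      refine ⟨_, h4, Or.inl ?_⟩
      rw [exp_ext_iff]
      simp
      omega
  · rw [h2] at hα
    obtain ⟨h3, h4 | h4⟩ := aux h1 hα
    · right; left
      rw [exp_ext_iff]
      simp
      omega
    · right; right; right
      refine ⟨_, h4, Or.inr ?_⟩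
      rw [exp_ext_iff]
      simp
      omega
  · left
    rw [expVec_eta] at hα
    refine (eq_of_mem_minZeroSet hα (isZeroExp_of_pos h one_pos one_pos) ?_).symm
    rw [exp_le_iff]
    simp
    omega

theorem noMixed_iff (h : IsUpTriple a b c) : NoMixed a b c ↔ mixedSet a b c = ∅ := by
  constructor
  · intro hP
    rw [Set.eq_empty_iff_forall_notMem]
    rintro ⟨i, j⟩ ⟨hi, hj, hmin⟩
    have h1 := eq_of_mem_minZeroSet hmin (β := expVec 0 0 j 0) (hP i j hmin.1)
      (by simp [exp_le_iff])
    have := (exp_ext_iff.mp h1).1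
    simp at this hi
    omega
  · intro hA i k hz
    obtain ⟨β, hβ, hle⟩ := exists_le_minZeroSet (α := expVec i 0 k 0) hz
    have hr := powExp_pos h
    rw [exp_le_iff] at hle
    simp at hle
    rcases minZeroSet_cases h hβ with rfl | rfl | rfl | ⟨q, hq, -⟩
    · simp at hle
    · simp at hle
      omega
    · simp at hle
      exact (powExp_spec h).symm.mono le_rfl le_rfl hle le_rfl
    · rw [hA] at hq
      exact absurd hq (Set.notMem_empty q)

/-- This keeps the monomial generators irredundant once the binomial is added: neither of its terms
can divide one of them. -/
theorem not_le_of_mem_minZeroSet (h : IsUpTriple a b c)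
    (hf : ¬ IsZeroExp a b c (symL a b c) 0 (symM a b c) 0) {i j k l : ℕ}
    (hγ : expVec i j k l ∈ minZeroSet a b c) :
    ¬ expVec (symL a b c) 0 (symM a b c) 0 ≤ expVec i j k l := by
  intro hle
  rw [exp_le_iff] at hle
  simp at hle
  obtain ⟨hi, hk⟩ := hle
  have hℓ := symL_pos h
  have hm := symM_pos h
  rcases Nat.eq_zero_or_pos j with rfl | hj
  swap
  · have := eq_of_mem_minZeroSet hγ (β := expVec 0 1 1 0) (isZeroExp_of_pos h one_pos one_pos)
      (by rw [exp_le_iff]; simp; omega)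
    have := (exp_ext_iff.mp this).1
    simp at this
    omega
  -- If `k = m`, pass through the binomial to cancel the surplus `z₁`, return, and cancel `z₄`; then
  -- `z₁^ℓ z₃^m` itself vanishes. If `k > m`, the vanishing monomial `z₁^(ℓ-1) z₃^(m+1)` is a proper
  -- divisor.
  rcases Nat.eq_or_lt_of_le hk with hk | hk
  · obtain ⟨e, rfl⟩ := Nat.exists_eq_add_of_le' hi
    have h1 : IsZeroExp a b c (e + symL a b c) 0 (symM a b c) l := hk ▸ hγ.1
    have h2 := (h1.congr h (sameExp_binomial h e l)).cancel_le h hm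
    have h3 := h2.congr h (sameExp_binomial h 0 l).symm
    rw [zero_add] at h3
    exact hf (h3.symm.cancel_le h hm).symm
  · have := eq_of_mem_minZeroSet hγ (β := expVec (symL a b c - 1) 0 (symM a b c + 1) 0)
      (isZeroExp_pred_symL h) (by rw [exp_le_iff]; simp; omega)
    have := (exp_ext_iff.mp this).1
    simp at this
    omega

variable (K : Type*) [Field K]

theorem image_minZeroSet (h : IsUpTriple a b c) :
    (fun s => monomial s (1 : K)) '' minZeroSet a b c =
      baseMonomials K (powExp h) ∪ mixedMonomials K (finite_mixedSet a b c).toFinset := by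
  rw [baseMonomials_eq]
  ext p
  simp only [mixedMonomials, Set.mem_union, Set.mem_image, Set.mem_insert_iff,
    Set.mem_singleton_iff, Set.mem_ofPred_eq, Set.Finite.mem_toFinset]
  have hm1 : ∀ q : ℕ × ℕ, (X 0 ^ q.1 * X 2 ^ q.2 : MvPolynomial (Fin 4) K) =
      monomial (expVec q.1 0 q.2 0) 1 := by simp [monomial_expVec]
  have hm2 : ∀ q : ℕ × ℕ, (X 1 ^ q.2 * X 3 ^ q.1 : MvPolynomial (Fin 4) K) =
      monomial (expVec 0 q.2 0 q.1) 1 := by simp [monomial_expVec]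
  simp only [hm1, hm2]
  constructor
  · rintro ⟨α, hα, rfl⟩
    rcases minZeroSet_cases h hα with rfl | rfl | rfl | ⟨q, hq, rfl | rfl⟩
    · exact Or.inl ⟨_, Or.inl rfl, rfl⟩
    · exact Or.inl ⟨_, Or.inr (Or.inl rfl), rfl⟩
    · exact Or.inl ⟨_, Or.inr (Or.inr rfl), rfl⟩
    · exact Or.inr ⟨q, hq, Or.inl rfl⟩
    · exact Or.inr ⟨q, hq, Or.inr rfl⟩
  · rintro (⟨α, (rfl | rfl | rfl), rfl⟩ | ⟨q, hq, rfl | rfl⟩)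
    · exact ⟨_, mul_mem_minZeroSet h, rfl⟩
    · exact ⟨_, pow_mem_minZeroSet h, rfl⟩
    · exact ⟨_, swap_mem_minZeroSet (pow_mem_minZeroSet h), rfl⟩
    · exact ⟨_, hq.2.2, rfl⟩
    · exact ⟨_, swap_mem_minZeroSet hq.2.2, rfl⟩

theorem span_eq_symDefIdeal (h : IsUpTriple a b c) {E : Set (MvPolynomial (Fin 4) K)}
    (hE : E ⊆ {symBinomial K a b c})
    (hE' : symBinomial K a b c ∈
      Ideal.span ((fun s => monomial s (1 : K)) '' minZeroSet a b c ∪ E)) :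
    Ideal.span ((fun s => monomial s (1 : K)) '' minZeroSet a b c ∪ E) = symDefIdeal K a b c := by
  apply le_antisymm
  · rw [Ideal.span_le]
    rintro _ (⟨α, hα, rfl⟩ | hp)
    · exact monomial_mem_symDefIdeal K h hα.1 1
    · rw [hE hp]
      exact symBinomial_mem K h
  · refine symDefIdeal_le K h (fun α hα => ?_) hE'
    refine Ideal.span_mono Set.subset_union_left (mem_ideal_span_monomial_image.mpr ?_)
    intro β hβ
    rw [Finset.mem_singleton.mp (support_monomial_subset hβ)]
    exact exists_le_minZeroSet hα

theorem monomial_ne_not_le {γ γ' : Fin 4 →₀ ℕ} (hγ : γ ∈ minZeroSet a b c)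
    (hγ' : γ' ∈ minZeroSet a b c) (hne : (monomial γ' (1 : K)) ≠ monomial γ 1) :
    ∀ α ∈ (monomial γ' (1 : K)).support, ¬ α ≤ γ := by
  intro α hα hle
  rw [Finset.mem_singleton.mp (support_monomial_subset hα)] at hle
  exact hne (by rw [eq_of_mem_minZeroSet hγ hγ'.1 hle])

theorem isMinimalGeneratingSet_of_isZeroExp (h : IsUpTriple a b c)
    (hf : IsZeroExp a b c (symL a b c) 0 (symM a b c) 0) :
    IsMinimalGeneratingSet ((fun s => monomial s (1 : K)) '' minZeroSet a b c)
      (symDefIdeal K a b c) := by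
  constructor
  · have := span_eq_symDefIdeal K h (E := ∅) (Set.empty_subset _) ?_
    · simpa using this
    · rw [Set.union_empty, symBinomial_eq]
      refine sub_mem ?_ ?_ <;>
      · rw [mem_ideal_span_monomial_image]
        intro β hβ
        rw [Finset.mem_singleton.mp (support_monomial_subset hβ)]
        first
        | exact exists_le_minZeroSet hf
        | refine exists_le_minZeroSet (hf.congr h (by simpa using sameExp_binomial h 0 0))
  · rintro _ ⟨γ, hγ, rfl⟩
    refine notMem_span_diff_singleton (γ := γ) (by simp) ?_
    rintro _ ⟨γ', hγ', rfl⟩ hne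
    exact monomial_ne_not_le K hγ hγ' hne

theorem isMinimalGeneratingSet_of_not_isZeroExp (h : IsUpTriple a b c)
    (hf : ¬ IsZeroExp a b c (symL a b c) 0 (symM a b c) 0) :
    IsMinimalGeneratingSet
      ((fun s => monomial s (1 : K)) '' minZeroSet a b c ∪ {symBinomial K a b c})
      (symDefIdeal K a b c) := by
  have hℓ := symL_pos h
  constructor
  · exact span_eq_symDefIdeal K h subset_rfl (Ideal.subset_span (Or.inr rfl))
  · rintro _ (⟨γ, hγ, rfl⟩ | rfl)
    · refine notMem_span_diff_singleton (γ := γ) (by simp) ?_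
      rintro _ (⟨γ', hγ', rfl⟩ | rfl) hne
      · exact monomial_ne_not_le K hγ hγ' hne
      · intro α hα
        rw [← expVec_eta γ] at hγ
        have h1 := not_le_of_mem_minZeroSet h hf hγ
        have h2 := not_le_of_mem_minZeroSet h hf (swap_mem_minZeroSet hγ)
        rw [exp_le_iff] at h1 h2
        simp at h1 h2
        rw [symBinomial_eq] at hα
        rcases Finset.mem_union.mp (support_sub _ _ _ hα) with H | H <;>
        · rw [Finset.mem_singleton.mp (support_monomial_subset H), exp_le_iff]
          simp
          omega
    · refine notMem_span_diff_singleton (γ := expVec (symL a b c) 0 (symM a b c) 0) ?_ ?_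
      · rw [symBinomial_eq, coeff_sub, coeff_monomial, coeff_monomial, if_pos rfl, if_neg]
        · simp
        · intro H
          have := (exp_ext_iff.mp H).1
          simp at this
          omega
      · rintro _ (⟨γ', hγ', rfl⟩ | rfl) hne
        · intro α hα hle
          rw [Finset.mem_singleton.mp (support_monomial_subset hα)] at hle
          exact hf (isUpperSet_zeroSet a b c hle hγ'.1)
        · exact absurd rfl hne

theorem toFinset_mixedSet_eq_empty (h : IsUpTriple a b c) (hP : NoMixed a b c) :
    (finite_mixedSet a b c).toFinset = ∅ := by
  rw [Set.Finite.toFinset_eq_empty]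
  exact (noMixed_iff h).mp hP

theorem mixedMonomials_empty : mixedMonomials K ∅ = ∅ := by
  simp [mixedMonomials]

theorem caseI_of (h : IsUpTriple a b c) (hP : NoMixed a b c)
    (hf : IsZeroExp a b c (symL a b c) 0 (symM a b c) 0) : CaseI K a b c := by
  have := isMinimalGeneratingSet_of_isZeroExp K h hf
  rw [image_minZeroSet K h, toFinset_mixedSet_eq_empty h hP, mixedMonomials_empty,
    Set.union_empty] at this
  exact ⟨_, this⟩

theorem mixedSet_nonempty (h : IsUpTriple a b c) (hP : ¬ NoMixed a b c) :
    (finite_mixedSet a b c).toFinset.Nonempty := by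
  rw [Set.Finite.toFinset_nonempty, Set.nonempty_iff_ne_empty]
  exact fun H => hP ((noMixed_iff h).mpr H)

theorem caseII_of (h : IsUpTriple a b c) (hP : ¬ NoMixed a b c)
    (hf : IsZeroExp a b c (symL a b c) 0 (symM a b c) 0) : CaseII K a b c := by
  have := isMinimalGeneratingSet_of_isZeroExp K h hf
  rw [image_minZeroSet K h] at this
  refine ⟨_, _, mixedSet_nonempty h hP, fun q hq => ?_, this⟩
  rw [Set.Finite.mem_toFinset] at hq
  exact ⟨hq.1, hq.2.1⟩

theorem caseIII_of (h : IsUpTriple a b c) (hP : NoMixed a b c)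
    (hf : ¬ IsZeroExp a b c (symL a b c) 0 (symM a b c) 0) : CaseIII K a b c := by
  have := isMinimalGeneratingSet_of_not_isZeroExp K h hf
  rw [image_minZeroSet K h, toFinset_mixedSet_eq_empty h hP, mixedMonomials_empty,
    Set.union_empty] at this
  -- `z₃^(m+1)` vanishes because `z₁^(ℓ-1) z₃^(m+1)` does, whereas `z₃^m` divides the surviving term
  -- `z₁^ℓ z₃^m`.
  have hr : powExp h = symM a b c + 1 := by
    apply le_antisymm
    · exact powExp_le h (hP _ _ (isZeroExp_pred_symL h)).symm
    · by_contra! H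
      exact hf ((powExp_spec h).symm.mono (Nat.zero_le _) le_rfl (by omega) le_rfl)
  rwa [hr] at this

theorem caseIV_of (h : IsUpTriple a b c) (hP : ¬ NoMixed a b c)
    (hf : ¬ IsZeroExp a b c (symL a b c) 0 (symM a b c) 0) : CaseIV K a b c := by
  have := isMinimalGeneratingSet_of_not_isZeroExp K h hf
  rw [image_minZeroSet K h, Set.union_right_comm] at this
  refine ⟨_, _, mixedSet_nonempty h hP, fun q hq => ?_, this⟩
  rw [Set.Finite.mem_toFinset] at hq
  exact ⟨hq.1, hq.2.1⟩

end

/-! ### Examples for the four cases, and the theorem. -/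

theorem noMixed_two_three_four : NoMixed 2 3 4 := by
  rintro i k ⟨p, q, s, t, h1, h2, h3, h4⟩
  have : 2 ≤ k := by omega
  have : IsZeroExp 2 3 4 0 0 2 0 := ⟨1, 0, 0, 1, by omega, by omega, by omega, by omega⟩
  exact this.mono (by omega) (by omega) (by omega) (by omega)

/-- Vanishing of `z₁ⁱz₃ᵏ` needs `k ≥ 3`, and `u₃³ = x⁶y¹⁵` is already a proper multiple of `u₁u₄² =
x⁶y¹²`. -/
theorem noMixed_two_five_six : NoMixed 2 5 6 := by
  rintro i k ⟨p, q, s, t, h1, h2, h3, h4⟩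
  have : 3 ≤ k := by omega
  have : IsZeroExp 2 5 6 0 0 3 0 := ⟨1, 0, 0, 2, by omega, by omega, by omega, by omega⟩
  exact this.mono (by omega) (by omega) (by omega) (by omega)

theorem theorem3p1 (K : Type*) [Field K] :
    (∀ a b c : ℕ, IsUpTriple a b c →
      (CaseI K a b c ∨ CaseII K a b c ∨ CaseIII K a b c ∨ CaseIV K a b c) ∧
      (SymFiberConeIsCM K a b c ↔ CaseI K a b c) ∧
      (¬ CaseI K a b c → symDepth K a b c = 1)) ∧
    (∃ a b c : ℕ, IsUpTriple a b c ∧ CaseI K a b c) ∧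
    (∃ a b c : ℕ, IsUpTriple a b c ∧ CaseII K a b c) ∧
    (∃ a b c : ℕ, IsUpTriple a b c ∧ CaseIII K a b c) ∧
    (∃ a b c : ℕ, IsUpTriple a b c ∧ CaseIV K a b c) := by
  refine ⟨fun a b c h => ?_, ?_, ?_, ?_, ?_⟩
  · have hdepth : ¬ CaseI K a b c → symDepth K a b c = 1 := by
      intro hI
      refine le_antisymm ?_ (one_le_symDepth K h)
      by_cases hP : NoMixed a b c
      · exact symDepth_le_one_of_noMixed K h hP fun hf => hI (caseI_of K h hP hf)
      · exact symDepth_le_one_of_not_noMixed K h hP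
    refine ⟨?_, ⟨fun hCM => ?_, fun hI => ?_⟩, hdepth⟩
    · by_cases hP : NoMixed a b c <;>
        by_cases hf : IsZeroExp a b c (symL a b c) 0 (symM a b c) 0
      · exact Or.inl (caseI_of K h hP hf)
      · exact Or.inr (Or.inr (Or.inl (caseIII_of K h hP hf)))
      · exact Or.inr (Or.inl (caseII_of K h hP hf))
      · exact Or.inr (Or.inr (Or.inr (caseIV_of K h hP hf)))
    · by_contra hI
      rw [SymFiberConeIsCM, hdepth hI, ringKrullDim_symFiberCone K h] at hCM
      exact absurd hCM (by decide)
    · rw [SymFiberConeIsCM, symDepth_eq_two K h hI, ringKrullDim_symFiberCone K h]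
      rfl
  · have h : IsUpTriple 2 3 4 := by simp [IsUpTriple]
    refine ⟨2, 3, 4, h, caseI_of K h noMixed_two_three_four ?_⟩
    have : symL 2 3 4 = 1 ∧ symM 2 3 4 = 4 := by decide
    rw [this.1, this.2]
    exact ⟨3, 0, 0, 2, by omega, by omega, by omega, by omega⟩
  · have h : IsUpTriple 2 7 8 := by simp [IsUpTriple]
    -- `u₁u₃³ = x¹⁴y²¹` is a proper multiple of `u₂²u₄² = x¹⁴y²⁰`, while `z₃³` survives. Since `c`
    -- and `b - a` are coprime, `m = c`, and the binomial is made of vanishing monomials.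
    refine ⟨2, 7, 8, h, caseII_of K h (fun hP => ?_) ?_⟩
    · obtain ⟨p, q, s, t, h1, h2, h3, h4⟩ :=
        hP 1 3 ⟨0, 2, 0, 2, by omega, by omega, by omega, by omega⟩
      have hs : s ≤ 2 := by omega
      have ht : t ≤ 3 := by omega
      interval_cases s <;> interval_cases t <;> omega
    · have : symL 2 7 8 = 5 ∧ symM 2 7 8 = 8 := by decide
      rw [this.1, this.2]
      exact ⟨6, 0, 0, 7, by omega, by omega, by omega, by omega⟩
  · have h : IsUpTriple 2 5 6 := by simp [IsUpTriple]
    refine ⟨2, 5, 6, h, caseIII_of K h noMixed_two_five_six ?_⟩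
    have : symL 2 5 6 = 1 ∧ symM 2 5 6 = 2 := by decide
    rw [this.1, this.2]
    rintro ⟨p, q, s, t, h1, h2, h3, h4⟩
    have hs : s ≤ 1 := by omega
    have ht : t ≤ 3 := by omega
    interval_cases s <;> interval_cases t <;> omega
  · have h : IsUpTriple 3 13 15 := by simp [IsUpTriple]
    -- `u₁u₃⁴ = x²⁷y⁵²` is a proper multiple of `u₂²u₄³ = x²⁶y⁵¹`, an instance of
    -- `isZeroExp_pred_symL` with `ℓ = 2`, `m = 3`, while `z₃⁴` and `z₁²z₃³` survive.
    refine ⟨3, 13, 15, h, caseIV_of K h (fun hP => ?_) ?_⟩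
    · obtain ⟨p, q, s, t, h1, h2, h3, h4⟩ :=
        hP 1 4 ⟨0, 2, 0, 3, by omega, by omega, by omega, by omega⟩
      have hs : s ≤ 3 := by omega
      have ht : t ≤ 4 := by omega
      interval_cases s <;> interval_cases t <;> omega
    · have : symL 3 13 15 = 2 ∧ symM 3 13 15 = 3 := by decide
      rw [this.1, this.2]
      rintro ⟨p, q, s, t, h1, h2, h3, h4⟩
      have hs : s ≤ 2 := by omega
      have ht : t ≤ 5 := by omega
      interval_cases s <;> interval_cases t <;> omega
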